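/- Let $K$ be a field of characteristic $0$, let $E/K$ be an elliptic curve, and let $\ell$ be a prime. For an extension field $F$ of $K$ write $E(F)[\ell^\infty]$ for the group of points $P\in E(F)$ with $\ell^kP=O$ for some $k\ge 0$. Suppose that $E(K)[\ell^\infty]\neq\{O\}$, and let $L/K$ be a field extension (not necessarily finite or algebraic) with $E(L)[\ell^\infty]\supsetneq E(K)[\ell^\infty]$. Let $\zeta_\ell$ be a primitive $\ell$-th root of unity in some extension field of $L$. Then at least one of the following holds: (i) there is a field $F$ with $K\subsetneq F\subseteq L$ such that $F/K$ is a finite Galois extension with cyclic Galois group; (ii) there is a field $F$ with $K(\zeta_\ell)\subseteq F\subseteq L(\zeta_\ell)$ such that $F/K(\zeta_\ell)$ is Galois with cyclic Galois group of degree $[F:K(\zeta_\ell)]=\ell$, and there is a field $F'$ with $K\subseteq F'\subseteq L$ and $[F':K]\in\{\ell,\ell^2\}$. -/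

import Mathlib

open scoped WeierstrassCurve.Affine IntermediateField

/-- `E(F)[ℓ^∞]`: the group of `F`-rational points of `E` killed by some power of `ℓ`,
where `E` is a Weierstrass curve over `K` and `F` is an extension field of `K`. -/
noncomputable abbrev ellPrimaryTorsion {K : Type*} [Field K] (E : WeierstrassCurve.Affine K)
    (F : Type*) [Field F] [DecidableEq F] [Algebra K F] (ℓ : ℕ) : AddSubgroup (E⁄F).Point :=
  AddCommGroup.primaryComponent (E⁄F).Point ℓ

/-- `L/K` is a cyclic extension: a finite Galois extension with cyclic Galois group. -/
def IsCyclicExtension (K L : Type*) [Field K] [Field L] [Algebra K L] : Prop :=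
  FiniteDimensional K L ∧ IsGalois K L ∧ IsCyclic (L ≃ₐ[K] L)

/-! Choose `P` of order `ℓ` in `E(K)` and a point `Q` of `E(L)` not defined over `K` with `ℓQ` in
`E(K)`; put `N = K(Q)`. Over an algebraically closed `F`, pairing with `P` is a Galois-equivariant
homomorphism `e : E[ℓ] → F^×` whose kernel lies in `⟨P⟩` (`exists_pairing`). It turns the cocycle `τ
↦ τQ - Q` into a multiplicative one, and Hilbert 90 yields a nonzero `α` in `N` with `τα = e(τQ - Q)
α`, so `α ^ ℓ` is in `K` (`exists_pow_eq`).

If `α` is in `K`, every `τQ - Q` lies in the rational group `⟨P⟩`; then `N/K` is Galois and its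
group embeds in `⟨P⟩` (`isGalois_and_isCyclic_of_conj`), which is case (i). Otherwise put `a = α ^
ℓ`. If `a = β ^ ℓ` with `β` in `K`, then `α/β` is a primitive `ℓ`-th root of unity outside `K`, and
it generates a cyclic extension. If not, `X ^ ℓ - a` is irreducible, `K(α)` has degree `ℓ`, and
irreducibility persists over `K(ζ)`, whose degree is less than `ℓ`; Kummer theory gives case (ii).

As `L/K` is arbitrary, finiteness of `N` needs proof (`isAlgebraic_of_nsmul_eq`). If `x(Q)` were
transcendental, `Q` would be a generic point with constant `ℓ`-multiple, and translating it would
give `ℓS = 0` for every `S` in `E(F)`. But `E[ℓ]` is finite, because `e` has values in the `ℓ`-th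
roots of unity and a finite kernel.

The pairing lives on the function field of `E` over `F`. Translation by `S` is the endomorphism
sending the generic point `G` to `G + S`, and the order at `S` is the order at infinity after
translation. Lines show that `(A) + (B) - (A + B) - (O)` is principal, so an `ℓ`-torsion point `T`
has a function `t` with divisor `∑ᵢ (T - iP) - ∑ᵢ (-iP)`. Translation by `P` preserves this divisor,
hence scales `t` by a constant, `e(T)`. If `e(T) = 1` with `T` outside `⟨P⟩`, then `t` is a
degree-one function on `E/⟨P⟩`, which would make that curve rational; `IsPairing.mem_zmultiples`
derives the contradiction from an eigenfunction of translation by `P`. -/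

set_option linter.unusedSectionVars false

namespace WeierstrassCurve.Affine

open Polynomial WithZero
open scoped Polynomial.Bivariate

/-! ### Pole order at infinity on the coordinate ring. -/

namespace CoordinateRing

variable {k : Type*} [Field k] (W : Affine k)

/-- The valuation on the coordinate ring whose value is the pole order at infinity. -/
noncomputable def inftyValuation : Valuation W.CoordinateRing ℤᵐ⁰ := by
  classical
  exact
  { toFun := fun r => if r = 0 then 0 else exp ((Algebra.norm k[X] r).natDegree : ℤ)
    map_zero' := by simp
    map_one' := by simp
    map_mul' := by
      intro r s
      by_cases hr : r = 0
      · simp [hr]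
      by_cases hs : s = 0
      · simp [hs]
      have h1 := Algebra.norm_ne_zero_iff_of_basis (CoordinateRing.basis W) |>.mpr hr
      have h2 := Algebra.norm_ne_zero_iff_of_basis (CoordinateRing.basis W) |>.mpr hs
      rw [if_neg (mul_ne_zero hr hs), if_neg hr, if_neg hs, map_mul, natDegree_mul h1 h2,
        ← exp_add]
      push_cast
      rfl
    map_add_le_max' := by
      intro r s
      by_cases hr : r = 0
      · simp [hr]
      by_cases hs : s = 0
      · simp [hs]
      by_cases hrs : r + s = 0
      · simp [hrs]
      have h1 := Algebra.norm_ne_zero_iff_of_basis (CoordinateRing.basis W) |>.mpr hr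
      have h2 := Algebra.norm_ne_zero_iff_of_basis (CoordinateRing.basis W) |>.mpr hs
      have h3 := Algebra.norm_ne_zero_iff_of_basis (CoordinateRing.basis W) |>.mpr hrs
      rw [if_neg hr, if_neg hs, if_neg hrs, le_max_iff, exp_le_exp, exp_le_exp]
      rw [Nat.cast_le, Nat.cast_le, ← le_max_iff]
      -- The norm of `p + q y` has degree `max (2 deg p) (2 deg q + 3)`, and each entry is
      -- ultrametric in `p`, `q`.
      suffices (Algebra.norm k[X] (r + s)).degree ≤
          max (Algebra.norm k[X] r).degree (Algebra.norm k[X] s).degree by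
        rw [degree_eq_natDegree h1, degree_eq_natDegree h2, degree_eq_natDegree h3] at this
        rw [le_max_iff] at this ⊢
        exact_mod_cast this
      obtain ⟨p, q, rfl⟩ := exists_smul_basis_eq r
      obtain ⟨p', q', rfl⟩ := exists_smul_basis_eq s
      have e : p • (1 : W.CoordinateRing) + q • CoordinateRing.mk W Y + (p' • 1 + q' • CoordinateRing.mk W Y) =
        (p + p') • 1 + (q + q') • CoordinateRing.mk W Y := by
        rw [add_smul, add_smul]; abel
      rw [e, degree_norm_smul_basis, degree_norm_smul_basis, degree_norm_smul_basis]
      have hp := degree_add_le p p'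
      have hq := degree_add_le q q'
      rcases le_max_iff.mp hp with hp | hp <;> rcases le_max_iff.mp hq with hq | hq
      all_goals
        refine max_le ?_ ?_
        · rw [two_nsmul (p + p').degree, two_nsmul p.degree, two_nsmul p'.degree]
          refine (add_le_add hp hp).trans ?_
          simp
        · rw [two_nsmul (q + q').degree, two_nsmul q.degree, two_nsmul q'.degree]
          refine (add_le_add (add_le_add hq hq) le_rfl).trans ?_
          simp }

lemma inftyValuation_apply {r : W.CoordinateRing} (hr : r ≠ 0) :
    inftyValuation W r = exp ((Algebra.norm k[X] r).natDegree : ℤ) :=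
  if_neg hr

lemma inftyValuation_ne_zero {r : W.CoordinateRing} (hr : r ≠ 0) : inftyValuation W r ≠ 0 := by
  rw [inftyValuation_apply W hr]; exact exp_ne_zero

end CoordinateRing

/-! ### The function field: coordinates, valuation at infinity, embeddings. -/

namespace FunctionField

open CoordinateRing

variable {k : Type*} [Field k] (W : Affine k)

/-- The valuation of the function field at infinity. -/
noncomputable def inftyValuation : Valuation W.FunctionField ℤᵐ⁰ :=
  (CoordinateRing.inftyValuation W).extendToLocalization (S := nonZeroDivisors W.CoordinateRing)
    (fun _ hs => inftyValuation_ne_zero W (nonZeroDivisors.ne_zero hs)) W.FunctionField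

lemma inftyValuation_algebraMap (r : W.CoordinateRing) :
    inftyValuation W (algebraMap _ W.FunctionField r) = CoordinateRing.inftyValuation W r :=
  Valuation.extendToLocalization_apply_map_apply _ _ _ _

/-- The coordinate function `x`. -/
noncomputable def x : W.FunctionField := algebraMap W.CoordinateRing _ (CoordinateRing.mk W (C X))

/-- The coordinate function `y`. -/
noncomputable def y : W.FunctionField := algebraMap W.CoordinateRing _ (CoordinateRing.mk W Y)

lemma algebraMap_eq (c : k) :
    algebraMap k W.FunctionField c = algebraMap W.CoordinateRing _ (CoordinateRing.mk W (C (C c))) := by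
  rw [IsScalarTower.algebraMap_apply k W.CoordinateRing W.FunctionField]
  rfl

lemma inftyValuation_x : inftyValuation W (x W) = exp 2 := by
  rw [x, inftyValuation_algebraMap]
  have h : CoordinateRing.mk W (C X) = (X : k[X]) • (1 : W.CoordinateRing) + (0 : k[X]) • CoordinateRing.mk W Y := by
    rw [CoordinateRing.smul, zero_smul, mul_one, add_zero]
  have hd := degree_norm_smul_basis (W' := W) X 0
  rw [← h] at hd
  simp only [degree_X, degree_zero] at hd
  have h0 : CoordinateRing.mk W (C X) ≠ 0 := by
    intro h0
    have := Module.Finite.of_basis (CoordinateRing.basis W)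
    rw [h0, Algebra.norm_zero, degree_zero] at hd
    exact absurd hd (by decide)
  rw [inftyValuation_apply W h0, exp_inj]
  have : (Algebra.norm k[X] (CoordinateRing.mk W (C X))).degree = (2 : ℕ) := by
    rw [hd]; rfl
  rw [natDegree_eq_of_degree_eq_some this]
  rfl

lemma inftyValuation_y : inftyValuation W (y W) = exp 3 := by
  rw [y, inftyValuation_algebraMap]
  have h : CoordinateRing.mk W Y = (0 : k[X]) • (1 : W.CoordinateRing) + (1 : k[X]) • CoordinateRing.mk W Y := by
    rw [zero_smul, zero_add, one_smul]
  have hd := degree_norm_smul_basis (W' := W) 0 1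
  rw [← h] at hd
  simp only [degree_one, degree_zero] at hd
  have h0 : CoordinateRing.mk W Y ≠ 0 := by
    intro h0
    have := Module.Finite.of_basis (CoordinateRing.basis W)
    rw [h0, Algebra.norm_zero, degree_zero] at hd
    exact absurd hd (by decide)
  rw [inftyValuation_apply W h0, exp_inj]
  have : (Algebra.norm k[X] (CoordinateRing.mk W Y)).degree = (3 : ℕ) := by
    rw [hd]; rfl
  rw [natDegree_eq_of_degree_eq_some this]
  rfl

lemma inftyValuation_const {c : k} (hc : c ≠ 0) :
    inftyValuation W (algebraMap k _ c) = 1 := by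
  rw [algebraMap_eq, inftyValuation_algebraMap]
  have h0 : CoordinateRing.mk W (C (C c)) ≠ 0 := by
    intro h0
    apply hc
    apply FaithfulSMul.algebraMap_injective k W.CoordinateRing
    rw [map_zero]; exact h0
  rw [inftyValuation_apply W h0]
  have : Algebra.norm k[X] (CoordinateRing.mk W (C (C c))) = (C c) ^ 2 := by
    have := Algebra.norm_algebraMap_of_basis (CoordinateRing.basis W) (C c)
    rw [Fintype.card_fin] at this
    exact this
  rw [this, ← C_pow, natDegree_C]
  rfl

lemma aeval_x (p : k[X]) : aeval (x W) p = algebraMap W.CoordinateRing _ (CoordinateRing.mk W (C p)) := by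
  have : (aeval (x W) : k[X] →ₐ[k] W.FunctionField).toRingHom =
      ((algebraMap W.CoordinateRing W.FunctionField).comp (CoordinateRing.mk W)).comp C := by
    ext c
    · simp only [AlgHom.toRingHom_eq_coe, RingHom.coe_comp, RingHom.coe_coe, Function.comp_apply,
        aeval_C]
      exact algebraMap_eq W c
    · simp [x]
  exact congr($this p)

lemma equation_x_y {K : Type*} [Field K] (E : Affine K) [Algebra K k] :
    (E⁄(E⁄k).FunctionField).Equation (x (E⁄k)) (y (E⁄k)) := by
  have h : CoordinateRing.mk (E⁄k) (Y ^ 2 + C (C (E⁄k).a₁ * X + C (E⁄k).a₃) * Y -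
      C (X ^ 3 + C (E⁄k).a₂ * X ^ 2 + C (E⁄k).a₄ * X + C (E⁄k).a₆)) = 0 := AdjoinRoot.mk_self
  have h := congrArg (algebraMap (E⁄k).CoordinateRing (E⁄k).FunctionField) h
  rw [WeierstrassCurve.Affine.equation_iff]
  simp only [map_sub, map_add, map_mul, map_pow, map_zero] at h
  have e (c : K) : algebraMap (E⁄k).CoordinateRing (E⁄k).FunctionField
      (CoordinateRing.mk (E⁄k) (C (C (algebraMap K k c)))) = algebraMap K _ c := by
    rw [← algebraMap_eq, ← IsScalarTower.algebraMap_apply]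
  have e1 : (E⁄k).a₁ = algebraMap K k E.a₁ := rfl
  have e2 : (E⁄k).a₂ = algebraMap K k E.a₂ := rfl
  have e3 : (E⁄k).a₃ = algebraMap K k E.a₃ := rfl
  have e4 : (E⁄k).a₄ = algebraMap K k E.a₄ := rfl
  have e6 : (E⁄k).a₆ = algebraMap K k E.a₆ := rfl
  rw [e1, e2, e3, e4, e6, e, e, e, e, e] at h
  change y (E⁄k) ^ 2 + algebraMap K _ E.a₁ * x (E⁄k) * y (E⁄k) + algebraMap K _ E.a₃ * y (E⁄k) =
    x (E⁄k) ^ 3 + algebraMap K _ E.a₂ * x (E⁄k) ^ 2 + algebraMap K _ E.a₄ * x (E⁄k) +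
      algebraMap K _ E.a₆
  rw [x, y]
  linear_combination h

/-- The cofactor is the conjugate of `r` under `y ↦ -y - a₁x - a₃`. -/
lemma exists_norm_mul (r : W.CoordinateRing) :
    ∃ s : W.CoordinateRing, r * s = CoordinateRing.mk W (C (Algebra.norm k[X] r)) := by
  obtain ⟨p, q, rfl⟩ := exists_smul_basis_eq r
  have := coe_norm_smul_basis (W' := W) p q
  refine ⟨CoordinateRing.mk W (C p + C q * (-(Y : k[X][Y]) - C (C W.a₁ * X + C W.a₃))), ?_⟩
  refine Eq.trans ?_ this.symm
  rw [map_mul, CoordinateRing.smul, CoordinateRing.smul, mul_one, map_add (CoordinateRing.mk W) (C p) (C q * X),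
    map_mul (CoordinateRing.mk W) (C q) X]

/-- Multiplying by the conjugate of the denominator makes the denominator a polynomial in `x`. -/
lemma exists_mul_eq (m : W.FunctionField) : ∃ p q h : k[X], h ≠ 0 ∧
    m * aeval (x W) h = aeval (x W) p + aeval (x W) q * y W := by
  obtain ⟨r, s, hs, rfl⟩ := IsFractionRing.div_surjective (A := W.CoordinateRing) m
  obtain ⟨s', hs'⟩ := exists_norm_mul W s
  have hs0 := nonZeroDivisors.ne_zero hs
  obtain ⟨p, q, h⟩ := exists_smul_basis_eq (r * s')
  refine ⟨p, q, Algebra.norm k[X] s,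
    (Algebra.norm_ne_zero_iff_of_basis (CoordinateRing.basis W)).mpr hs0, ?_⟩
  rw [aeval_x, aeval_x, aeval_x, y, ← hs', ← map_mul, ← map_add, ← CoordinateRing.smul]
  have : q • CoordinateRing.mk W Y = CoordinateRing.mk W (C q) * CoordinateRing.mk W Y := CoordinateRing.smul q _
  rw [show CoordinateRing.mk W (C p) + q • CoordinateRing.mk W Y = r * s' by rw [← h, CoordinateRing.smul p, mul_one]]
  have hs1 : algebraMap W.CoordinateRing W.FunctionField s ≠ 0 := by
    simpa using hs0
  rw [map_mul, map_mul]
  field_simp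

/-- A point of `W` with transcendental `x`-coordinate in a field extension `N`, taken along
`φ : k → N`, induces an embedding of the function field. -/
lemma exists_lift {N : Type*} [Field N] (φ : k →+* N) (a b : N)
    (h : (W.map φ).toAffine.Equation a b) (ha : ∀ p : k[X], p ≠ 0 → p.eval₂ φ a ≠ 0) :
    ∃ f : W.FunctionField →+* N, (∀ c, f (algebraMap k _ c) = φ c) ∧ f (x W) = a ∧ f (y W) = b := by
  let g : W.CoordinateRing →+* N := AdjoinRoot.lift (eval₂RingHom φ a) b (by
    rw [polynomial]
    have := (WeierstrassCurve.Affine.equation_iff ..).mp h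
    simp [eval₂_add, eval₂_mul, eval₂_pow]
    simp at this
    linear_combination this)
  have g1 (p : k[X]) : g (CoordinateRing.mk W (C p)) = p.eval₂ φ a := AdjoinRoot.lift_of _
  have g2 : g (CoordinateRing.mk W Y) = b := AdjoinRoot.lift_root _
  -- The norm of an element is a multiple of it, so a nonzero kernel element would give a nonzero
  -- polynomial vanishing at `a`.
  have hg : Function.Injective g := by
    rw [injective_iff_map_eq_zero]
    intro r hr
    by_contra hr0
    obtain ⟨s, hs⟩ := exists_norm_mul W r
    have := congrArg g hs
    rw [map_mul, hr, zero_mul, g1] at this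
    exact ha _ ((Algebra.norm_ne_zero_iff_of_basis (CoordinateRing.basis W)).mpr hr0) this.symm
  refine ⟨IsFractionRing.lift hg, fun c => ?_, ?_, ?_⟩
  · rw [algebraMap_eq, IsFractionRing.lift_algebraMap, g1, eval₂_C]
  · rw [x, IsFractionRing.lift_algebraMap, g1, eval₂_X]
  · rw [y, IsFractionRing.lift_algebraMap, g2]

end FunctionField

/-- A function field `M` of an elliptic curve `E` over `F`, with its coordinate functions, its
valuation at infinity, and the extension of embeddings determined by transcendental points. -/
structure FunctionFieldModel {K : Type*} [Field K] (E : Affine K) (F M : Type*) [Field F] [Field M]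
    [Algebra K F] [Algebra F M] [Algebra K M] where
  /-- the coordinate function `x` -/
  x : M
  /-- the coordinate function `y` -/
  y : M
  equation : (E⁄M).Equation x y
  /-- the valuation at infinity -/
  v : Valuation M ℤᵐ⁰
  v_const : ∀ c : F, c ≠ 0 → v (algebraMap F M c) = 1
  v_x : v x = exp 2
  v_y : v y = exp 3
  exists_mul_eq : ∀ m : M, ∃ p q h : F[X], h ≠ 0 ∧ m * aeval x h = aeval x p + aeval x q * y
  -- `φ` is only required to be `K`-linear, so that automorphisms of `F` over `K` extend to `M`;
  -- Galois equivariance of the pairing rests on this.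
  exists_lift : ∀ (φ : F →ₐ[K] M) (a b : M), (E⁄M).Equation a b →
    (∀ p : F[X], p ≠ 0 → p.eval₂ (φ : F →+* M) a ≠ 0) →
    ∃ f : M →ₐ[K] M, (∀ c, f (algebraMap F M c) = φ c) ∧ f x = a ∧ f y = b

namespace FunctionFieldModel

/-! ### Uniqueness and residues of the valuation at infinity. -/

section Valuation

variable {K F M : Type*} [Field K] {E : Affine K} [Field F] [Field M]
  [Algebra K F] [Algebra F M] [Algebra K M] (D : FunctionFieldModel E F M)

/-- Valuations with the normalised behaviour of the valuation at infinity. -/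
structure IsInfty (w : Valuation M ℤᵐ⁰) : Prop where
  const : ∀ c : F, c ≠ 0 → w (algebraMap F M c) = 1
  x : w D.x = exp 2
  y : w D.y = exp 3

lemma isInfty_v : D.IsInfty D.v := ⟨D.v_const, D.v_x, D.v_y⟩

variable {D} {w w' : Valuation M ℤᵐ⁰}

lemma IsInfty.const_le (hw : D.IsInfty w) (c : F) : w (algebraMap F M c) ≤ 1 := by
  by_cases hc : c = 0
  · simp [hc]
  · exact (hw.const c hc).le

/-- The leading term strictly dominates, since `x` has a pole and nonzero constants have value `1`.
-/
lemma IsInfty.aeval (hw : D.IsInfty w) {p : F[X]} (hp : p ≠ 0) :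
    w (aeval D.x p) = exp (2 * p.natDegree : ℤ) := by
  induction hn : p.natDegree using Nat.strong_induction_on generalizing p with
  | _ n ih =>
    have hlead : w (Polynomial.aeval D.x (C p.leadingCoeff * X ^ n)) = exp (2 * n : ℤ) := by
      rw [map_mul, aeval_C, map_pow, aeval_X, map_mul, map_pow, hw.x,
        hw.const _ (leadingCoeff_ne_zero.mpr hp), one_mul, ← exp_nsmul]
      congr 1
      simp [mul_comm]
    have hdec : p = p.eraseLead + C p.leadingCoeff * X ^ n := by
      rw [← hn]; exact (eraseLead_add_C_mul_X_pow p).symm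
    by_cases he : p.eraseLead = 0
    · rw [hdec, he, zero_add, hlead]
    · have hlt : p.eraseLead.natDegree < n := by
        rcases eraseLead_natDegree_lt_or_eraseLead_eq_zero p with h | h
        · exact hn ▸ h
        · exact absurd h he
      rw [hdec, map_add, Valuation.map_add_eq_of_lt_right, hlead]
      rw [ih _ hlt he rfl, hlead, exp_lt_exp]
      omega

lemma IsInfty.aeval_mul_y (hw : D.IsInfty w) {q : F[X]} (hq : q ≠ 0) :
    w (Polynomial.aeval D.x q * D.y) = exp (2 * q.natDegree + 3 : ℤ) := by
  rw [map_mul, hw.aeval hq, hw.y, ← exp_add]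

/-- No cancellation can occur: the pole order of `p(x)` is even and that of `q(x) y` is odd. -/
lemma IsInfty.add_eq_max (hw : D.IsInfty w) (p q : F[X]) :
    w (Polynomial.aeval D.x p + Polynomial.aeval D.x q * D.y) =
      max (w (Polynomial.aeval D.x p)) (w (Polynomial.aeval D.x q * D.y)) := by
  by_cases hp : p = 0
  · simp [hp]
  by_cases hq : q = 0
  · simp [hq]
  apply Valuation.map_add_of_distinct_val
  rw [hw.aeval hp, hw.aeval_mul_y hq, Ne, exp_inj]
  omega

lemma aeval_ne_zero {p : F[X]} (hp : p ≠ 0) : aeval D.x p ≠ 0 := by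
  intro h
  have := D.isInfty_v.aeval hp
  rw [h, map_zero] at this
  exact exp_ne_zero this.symm

/-- The values on constants, `x` and `y` force all others. Hence negation and the extended Galois
automorphisms preserve `v`, as only these values need checking. -/
lemma IsInfty.eq (hw : D.IsInfty w) (hw' : D.IsInfty w') : w = w' := by
  ext m
  obtain ⟨p, q, h, hh, e⟩ := D.exists_mul_eq m
  have key : ∀ p : F[X], w (Polynomial.aeval D.x p) = w' (Polynomial.aeval D.x p) := by
    intro p
    by_cases hp : p = 0
    · simp [hp]
    · rw [hw.aeval hp, hw'.aeval hp]
  have h1 := congrArg w e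
  have h2 := congrArg w' e
  rw [hw.add_eq_max, map_mul, map_mul, hw.y, key, key, key] at h1
  rw [hw'.add_eq_max, map_mul, map_mul, hw'.y] at h2
  rw [← h2] at h1
  refine mul_right_cancel₀ ?_ h1
  rw [Ne, Valuation.zero_iff]
  exact aeval_ne_zero hh

variable (D)

lemma exists_residue {f : M} (hf : D.v f ≤ 1) : ∃ c : F, D.v (f - algebraMap F M c) < 1 := by
  obtain ⟨p, q, h, hh, e⟩ := D.exists_mul_eq f
  have hv := D.isInfty_v
  have hle : D.v (aeval D.x p + aeval D.x q * D.y) ≤ exp (2 * h.natDegree : ℤ) := by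
    rw [← e, map_mul, hv.aeval hh]
    exact mul_le_of_le_one_left' hf
  rw [hv.add_eq_max, max_le_iff] at hle
  -- The residue of `(p + q y)/h`: here `deg p ≤ deg h` and the `q y` term has strictly smaller pole
  -- order than `h`, so only the coefficients in degree `deg h` matter.
  refine ⟨p.coeff h.natDegree / h.leadingCoeff, ?_⟩
  set c := p.coeff h.natDegree / h.leadingCoeff with hc
  have e' : (f - algebraMap F M c) * aeval D.x h =
      aeval D.x (p - C c * h) + aeval D.x q * D.y := by
    rw [sub_mul, e, map_sub, map_mul, aeval_C]; ring
  have hlt : D.v (aeval D.x (p - C c * h) + aeval D.x q * D.y) < exp (2 * h.natDegree : ℤ) := by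
    rw [hv.add_eq_max, max_lt_iff]
    constructor
    · by_cases h0 : p - C c * h = 0
      · simp [h0]
      rw [hv.aeval h0, exp_lt_exp]
      have hp : p.natDegree ≤ h.natDegree := by
        by_cases hp0 : p = 0
        · simp [hp0]
        have := hle.1
        rw [hv.aeval hp0, exp_le_exp] at this
        omega
      have h1 : (p - C c * h).natDegree ≤ h.natDegree :=
        (natDegree_sub_le_of_le hp (natDegree_C_mul_le _ _)).trans_eq (max_self _)
      have h2 : (p - C c * h).natDegree ≠ h.natDegree := by
        intro h2
        apply leadingCoeff_ne_zero.mpr h0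
        rw [leadingCoeff, h2, coeff_sub, coeff_C_mul, coeff_natDegree, hc,
          div_mul_cancel₀ _ (leadingCoeff_ne_zero.mpr hh), sub_self]
      omega
    · by_cases hq : q = 0
      · simp [hq]
      have := hle.2
      rw [hv.aeval_mul_y hq, exp_le_exp] at this
      rw [hv.aeval_mul_y hq, exp_lt_exp]
      omega
  rw [← e', map_mul, hv.aeval hh] at hlt
  by_contra hcon
  exact absurd hlt (not_lt.mpr (le_mul_of_one_le_left' (not_lt.mp hcon)))

end Valuation

end FunctionFieldModel

instance isElliptic_baseChange {K M : Type*} [Field K] [Field M] [Algebra K M] (E : Affine K)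
    [E.IsElliptic] : (E⁄M).IsElliptic :=
  inferInstanceAs (WeierstrassCurve.IsElliptic (WeierstrassCurve.map E (algebraMap K M)))

namespace FunctionFieldModel

/-! ### Translations as endomorphisms of the function field. -/

section Translation

variable {K F M : Type*} [Field K] {E : Affine K} [E.IsElliptic] [Field F] [Field M]
  [Algebra K F] [Algebra F M] [Algebra K M] [IsScalarTower K F M]
  (D : FunctionFieldModel E F M)

/-- The generic point. -/
noncomputable def generic : (E⁄M).Point := .some D.x D.y (equation_iff_nonsingular.mp D.equation)

variable (M) in
/-- Constant points. -/
noncomputable def constPoint [DecidableEq F] [DecidableEq M] (S : (E⁄F).Point) : (E⁄M).Point :=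
  Point.baseChange (W' := E) F M S

section

variable [IsAlgClosed F]

lemma exists_algebraMap_eq_of_root {a : M} {p : F[X]} (hp : p ≠ 0) (ha : aeval a p = 0) :
    ∃ s : F, algebraMap F M s = a := by
  have h : _root_.IsIntegral F a := IsAlgebraic.isIntegral ⟨p, hp, ha⟩
  obtain ⟨s, hs⟩ := (IsAlgClosed.algebraMap_bijective_of_isIntegral (k := F)
    (K := integralClosure F M)).2 ⟨a, h⟩
  exact ⟨s, congrArg Subtype.val hs⟩

end
variable [DecidableEq F] [DecidableEq M]

lemma constPoint_add (S T : (E⁄F).Point) :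
    constPoint M (S + T) = constPoint M S + constPoint M T := map_add _ _ _

lemma constPoint_zero : constPoint (E := E) M (0 : (E⁄F).Point) = 0 := rfl

lemma constPoint_injective : Function.Injective (constPoint (E := E) (F := F) M) :=
  Point.map_injective _

lemma constPoint_some {s t : F} (h : (E⁄F).Nonsingular s t) :
    ∃ h', constPoint (E := E) M (.some s t h) = .some (algebraMap F M s) (algebraMap F M t) h' :=
  ⟨_, rfl⟩

lemma map_constPoint (f : M →ₐ[F] M) (S : (E⁄F).Point) :
    Point.map (W' := E) f (constPoint M S) = constPoint M S :=
  Point.map_baseChange f S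

lemma generic_ne_constPoint (S : (E⁄F).Point) : D.generic ≠ constPoint M S := by
  intro h
  rcases S with _ | ⟨s, t, hst⟩
  · exact Point.some_ne_zero _ h
  · have hx : D.x = algebraMap F M s := (Point.some.inj h).1
    have h1 := D.isInfty_v.aeval (X_sub_C_ne_zero s)
    rw [map_sub, aeval_X, aeval_C, hx, sub_self, map_zero] at h1
    exact exp_ne_zero h1.symm

section

variable [IsAlgClosed F]

/-- If `a` is algebraic over the algebraically closed `F` it lies in `F`, and then so does `b`, a
root of a monic quadratic over `F`. -/
lemma exists_constPoint_eq_or (P : (E⁄M).Point) : (∃ S : (E⁄F).Point, constPoint M S = P) ∨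
    ∃ a b h, P = .some a b h ∧ ∀ p : F[X], p ≠ 0 → aeval a p ≠ 0 := by
  rcases P with _ | ⟨a, b, h⟩
  · exact .inl ⟨0, rfl⟩
  by_cases ha : ∃ p : F[X], p ≠ 0 ∧ aeval a p = 0
  · obtain ⟨p, hp, hpa⟩ := ha
    obtain ⟨s, rfl⟩ := exists_algebraMap_eq_of_root hp hpa
    have heq := (equation_iff ..).mp h.1
    have e1 : (E⁄M).a₁ = algebraMap F M (E⁄F).a₁ := IsScalarTower.algebraMap_apply K F M _
    have e2 : (E⁄M).a₂ = algebraMap F M (E⁄F).a₂ := IsScalarTower.algebraMap_apply K F M _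
    have e3 : (E⁄M).a₃ = algebraMap F M (E⁄F).a₃ := IsScalarTower.algebraMap_apply K F M _
    have e4 : (E⁄M).a₄ = algebraMap F M (E⁄F).a₄ := IsScalarTower.algebraMap_apply K F M _
    have e6 : (E⁄M).a₆ = algebraMap F M (E⁄F).a₆ := IsScalarTower.algebraMap_apply K F M _
    have hq : (X ^ 2 + C ((E⁄F).a₁ * s + (E⁄F).a₃) * X -
        C (s ^ 3 + (E⁄F).a₂ * s ^ 2 + (E⁄F).a₄ * s + (E⁄F).a₆)).natDegree = 2 := by
      compute_degree!
    obtain ⟨t, rfl⟩ := exists_algebraMap_eq_of_root (F := F) (a := b)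
      (p := X ^ 2 + C ((E⁄F).a₁ * s + (E⁄F).a₃) * X -
        C (s ^ 3 + (E⁄F).a₂ * s ^ 2 + (E⁄F).a₄ * s + (E⁄F).a₆))
      (by intro h0; rw [h0] at hq; simp at hq)
      (by
        simp only [map_sub, map_add, map_mul, map_pow, aeval_X, aeval_C]
        rw [e1, e2, e3, e4, e6] at heq
        linear_combination heq)
    have hst := (E.baseChange_nonsingular
      (f := Algebra.ofId F M) (FaithfulSMul.algebraMap_injective F M) s t).mp h
    exact .inl ⟨.some s t hst, rfl⟩
  · push Not at ha
    exact .inr ⟨a, b, h, rfl, ha⟩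

/-- The generic point plus a constant point is not constant, so its `x`-coordinate is transcendental
and it defines an embedding. -/
lemma exists_translation (S : (E⁄F).Point) : ∃ f : M →ₐ[F] M,
    Point.map (W' := E) f D.generic = D.generic + constPoint M S := by
  rcases exists_constPoint_eq_or (E := E) (F := F) (D.generic + constPoint M S) with
    ⟨T, hT⟩ | ⟨a, b, h, hab, ha⟩
  · exfalso
    apply D.generic_ne_constPoint (T + -S)
    rw [constPoint_add, hT, add_assoc, ← constPoint_add, add_neg_cancel, constPoint_zero, add_zero]
  · obtain ⟨f, hf, hx, hy⟩ := D.exists_lift (IsScalarTower.toAlgHom K F M) a b h.1 ha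
    refine ⟨{ f with commutes' := hf }, ?_⟩
    rw [hab]
    subst hx hy
    rfl

/-- Translation by `S` on the function field. -/
noncomputable def translation (S : (E⁄F).Point) : M →ₐ[F] M := (D.exists_translation S).choose

lemma map_translation_generic (S : (E⁄F).Point) :
    Point.map (W' := E) (D.translation S) D.generic = D.generic + constPoint M S :=
  (D.exists_translation S).choose_spec

end

/-- This reduces identities between embeddings of `M` to identities in the group `E(M)`. -/
lemma algHom_eq {f g : M →ₐ[K] M}
    (h : ∀ c : F, f (algebraMap F M c) = g (algebraMap F M c))
    (hG : Point.map (W' := E) f D.generic = Point.map g D.generic) : f = g := by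
  have hx : f D.x = g D.x := (Point.some.inj hG).1
  have hy : f D.y = g D.y := (Point.some.inj hG).2
  have key (p : F[X]) : f (aeval D.x p) = g (aeval D.x p) := by
    rw [aeval_def, ← AlgHom.coe_toRingHom, ← AlgHom.coe_toRingHom g, hom_eval₂, hom_eval₂]
    congr 1
    ext c
    exact h c
  ext m
  obtain ⟨p, q, r, hr, e⟩ := D.exists_mul_eq m
  have h1 := congrArg f e
  have h2 := congrArg g e
  rw [map_mul, map_add, map_mul, key, key, key, hy] at h1
  rw [map_mul, map_add, map_mul] at h2
  refine mul_right_cancel₀ ?_ (h1.trans h2.symm)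
  rw [Ne, map_eq_zero]
  exact aeval_ne_zero hr

lemma algHom_eq' {f g : M →ₐ[F] M}
    (hG : Point.map (W' := E) f D.generic = Point.map g D.generic) : f = g := by
  have := D.algHom_eq (f := f.restrictScalars K) (g := g.restrictScalars K)
    (fun c => by simp) hG
  ext m
  exact congr($this m)

variable [IsAlgClosed F]

lemma translation_translation (S T : (E⁄F).Point) (m : M) :
    D.translation S (D.translation T m) = D.translation (S + T) m := by
  have : (D.translation S).comp (D.translation T) = D.translation (S + T) := by
    apply D.algHom_eq'
    rw [← Point.map_map, map_translation_generic, map_add, map_translation_generic,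
      map_constPoint, map_translation_generic, constPoint_add, add_assoc]
  exact congr($this m)

lemma translation_zero (m : M) : D.translation 0 m = m := by
  have : D.translation 0 = AlgHom.id F M := by
    apply D.algHom_eq'
    rw [map_translation_generic, constPoint_zero, add_zero]
    rfl
  exact congr($this m)

lemma translation_injective : Function.Injective D.translation := by
  intro S T h
  have := D.map_translation_generic S
  rw [h, map_translation_generic] at this
  exact (constPoint_injective (add_left_cancel this)).symm

end Translation

/-! ### Local behaviour at a point, read off from translation. -/

section Local

variable {K F M : Type*} [Field K] {E : Affine K} [E.IsElliptic] [Field F] [Field M]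
  [Algebra K F] [Algebra F M] [Algebra K M] [IsScalarTower K F M] [IsAlgClosed F]
  [DecidableEq F] [DecidableEq M] (D : FunctionFieldModel E F M)

lemma v_x_sub (s : F) : D.v (D.x - algebraMap F M s) = exp 2 := by
  have := D.isInfty_v.aeval (X_sub_C_ne_zero s)
  rwa [map_sub, aeval_X, aeval_C, natDegree_X_sub_C] at this

lemma v_add_mul_y (t : F) (ht : t ≠ 0) (p : F[X]) (hp : p.natDegree ≤ 1) :
    D.v (aeval D.x p + algebraMap F M t * D.y) = exp 3 := by
  have h1 := D.isInfty_v.add_eq_max p (C t)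
  have h2 := D.isInfty_v.aeval_mul_y (C_ne_zero.mpr ht)
  rw [aeval_C] at h1 h2
  rw [h1, h2, natDegree_C]
  apply max_eq_right
  by_cases hp0 : p = 0
  · simp [hp0]
  rw [D.isInfty_v.aeval hp0, exp_le_exp]
  omega

lemma v_y_sub (t : F) : D.v (D.y - algebraMap F M t) = exp 3 := by
  have := D.v_add_mul_y 1 one_ne_zero (C (-t)) (by simp)
  rw [aeval_C, map_one, one_mul, map_neg] at this
  rw [sub_eq_neg_add]
  exact this

lemma x_sub_ne_zero (s : F) : D.x - algebraMap F M s ≠ 0 := by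
  intro h
  have := D.v_x_sub s
  rw [h, map_zero] at this
  exact exp_ne_zero this.symm

lemma algebraMap_coeff : (E⁄M).a₁ = algebraMap F M (E⁄F).a₁ ∧ (E⁄M).a₂ = algebraMap F M (E⁄F).a₂ ∧
    (E⁄M).a₃ = algebraMap F M (E⁄F).a₃ ∧ (E⁄M).a₄ = algebraMap F M (E⁄F).a₄ ∧
    (E⁄M).a₆ = algebraMap F M (E⁄F).a₆ :=
  ⟨IsScalarTower.algebraMap_apply K F M _, IsScalarTower.algebraMap_apply K F M _,
    IsScalarTower.algebraMap_apply K F M _, IsScalarTower.algebraMap_apply K F M _,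
    IsScalarTower.algebraMap_apply K F M _⟩

/-- These are the addition formulas with denominators cleared and simplified by both curve
equations, so that pole orders at infinity are visible term by term. `B` and `-C` are the partial
derivatives in `y` and `x` of the equation at `(s, t)`. -/
lemma translation_x_y {s t : F} (h : (E⁄F).Nonsingular s t) (a₁ B C : M)
    (ha : a₁ = algebraMap F M (E⁄F).a₁)
    (hB : B = algebraMap F M (2 * t + (E⁄F).a₁ * s + (E⁄F).a₃))
    (hC : C = algebraMap F M (3 * s ^ 2 + 2 * (E⁄F).a₂ * s + (E⁄F).a₄ - (E⁄F).a₁ * t)) :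
    (D.translation (.some s t h) D.x - algebraMap F M s) * (D.x - algebraMap F M s) ^ 2 =
        C * (D.x - algebraMap F M s) - B * (D.y - algebraMap F M t) ∧
    (D.translation (.some s t h) D.y - algebraMap F M t) * (D.x - algebraMap F M s) ^ 3 =
        B * algebraMap F M ((E⁄F).a₂ + 3 * s) * (D.x - algebraMap F M s) ^ 2
          + B * C * (D.x - algebraMap F M s) - B ^ 2 * (D.y - algebraMap F M t)
          - C * (D.x - algebraMap F M s) * (D.y - algebraMap F M t)
          - a₁ * C * (D.x - algebraMap F M s) ^ 2 := by
  have hG := D.map_translation_generic (.some s t h)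
  have hu := D.x_sub_ne_zero s
  obtain ⟨h', hc⟩ := constPoint_some (E := E) (M := M) h
  rw [hc, generic, Point.add_of_X_ne (sub_ne_zero.mp hu)] at hG
  obtain ⟨hx, hy⟩ := Point.some.inj hG
  change D.translation (.some s t h) D.x = _ at hx
  change D.translation (.some s t h) D.y = _ at hy
  obtain ⟨e1, e2, e3, e4, e6⟩ := algebraMap_coeff (E := E) (F := F) (M := M)
  have hD := (equation_iff ..).mp D.equation
  have hS := congrArg (algebraMap F M) ((equation_iff ..).mp h.1)
  simp only [map_add, map_mul, map_pow] at hS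
  rw [slope_of_X_ne (sub_ne_zero.mp hu)] at hx hy
  rw [addY, negY, negAddY, ← hx] at hy
  rw [addX] at hx
  rw [e1, e2, e3, e4, e6] at hD
  rw [e1, e2] at hx
  rw [e1, e3] at hy
  simp only [map_add, map_mul, map_pow, map_sub, map_ofNat] at hB hC ⊢
  rw [← ha] at *
  clear hG hc e1 e2 e3 e4 e6 h'
  generalize algebraMap F M s = s at *
  generalize algebraMap F M t = t at *
  generalize algebraMap F M (E⁄F).a₂ = a₂ at *
  generalize algebraMap F M (E⁄F).a₃ = a₃ at *
  generalize algebraMap F M (E⁄F).a₄ = a₄ at *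
  generalize algebraMap F M (E⁄F).a₆ = a₆ at *
  generalize D.translation (.some _ _ h) D.x = x' at *
  generalize D.translation (.some _ _ h) D.y = y' at *
  generalize D.x = x at *
  generalize D.y = y at *
  have hl : (y - t) / (x - s) * (x - s) = y - t := div_mul_cancel₀ _ hu
  generalize (y - t) / (x - s) = l at *
  have h1 : (x' - s) * (x - s) ^ 2 = C * (x - s) - B * (y - t) := by
    rw [hx, hB, hC]
    linear_combination (l * (x - s) + (y - t) + a₁ * (x - s)) * hl + hD - hS
  refine ⟨h1, ?_⟩
  have h2 : (y' - t) * (x - s) ^ 3 = -((y - t) + a₁ * (x - s)) * ((x' - s) * (x - s) ^ 2) -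
      B * (x - s) ^ 3 := by
    rw [hy, hB]
    linear_combination ((x - s) ^ 2 * (x - x')) * hl
  rw [h2, h1, hB, hC]
  linear_combination (2 * t + a₁ * s + a₃) * (hD - hS)

/-- The valuation at the point `S`. -/
noncomputable def vAt (S : (E⁄F).Point) : Valuation M ℤᵐ⁰ :=
  D.v.comap (D.translation S : M →+* M)

lemma vAt_apply (S : (E⁄F).Point) (f : M) : D.vAt S f = D.v (D.translation S f) := rfl

lemma vAt_zero : D.vAt 0 = D.v := by
  ext f
  rw [vAt_apply, translation_zero]

lemma vAt_translation (S T : (E⁄F).Point) (f : M) :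
    D.vAt S (D.translation T f) = D.vAt (S + T) f := by
  rw [vAt_apply, translation_translation, vAt_apply]

lemma vAt_const (S : (E⁄F).Point) {c : F} (hc : c ≠ 0) : D.vAt S (algebraMap F M c) = 1 := by
  rw [vAt_apply, AlgHom.commutes, D.v_const c hc]

lemma vAt_const_le (S : (E⁄F).Point) (c : F) : D.vAt S (algebraMap F M c) ≤ 1 := by
  rw [vAt_apply, AlgHom.commutes]
  exact D.isInfty_v.const_le c

lemma mul_exp_eq {a : ℤᵐ⁰} {m n : ℤ} (h : a * exp m = exp n) : a = exp (n - m) := by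
  rw [exp_sub, ← h, mul_div_cancel_right₀ _ exp_ne_zero]

/-- When `B ≠ 0` the term `B (y - t)`, of pole order 3, dominates, and the factor `(x - s) ^ 2` has
pole order 4. -/
lemma vAt_x_sub_of_ne {s t : F} (h : (E⁄F).Nonsingular s t)
    (hB : 2 * t + (E⁄F).a₁ * s + (E⁄F).a₃ ≠ 0) :
    D.vAt (.some s t h) (D.x - algebraMap F M s) = exp (-1) := by
  have h1 := congrArg D.v (D.translation_x_y h _ _ _ rfl rfl rfl).1
  have h2 : D.v (algebraMap F M (3 * s ^ 2 + 2 * (E⁄F).a₂ * s + (E⁄F).a₄ - (E⁄F).a₁ * t) *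
      (D.x - algebraMap F M s)) < D.v (algebraMap F M (2 * t + (E⁄F).a₁ * s + (E⁄F).a₃) *
      (D.y - algebraMap F M t)) := by
    rw [map_mul, map_mul, v_x_sub, v_y_sub, D.v_const _ hB, one_mul]
    refine lt_of_le_of_lt (mul_le_of_le_one_left' (D.isInfty_v.const_le _)) ?_
    rw [exp_lt_exp]; norm_num
  rw [Valuation.map_sub_eq_of_lt_right _ h2, map_mul, map_pow, v_x_sub, map_mul, v_y_sub,
    D.v_const _ hB, one_mul, ← exp_nsmul] at h1
  rw [vAt_apply, map_sub, AlgHom.commutes, mul_exp_eq h1]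
  rfl

lemma nonsingular_coeff {s t : F} (h : (E⁄F).Nonsingular s t)
    (hB : 2 * t + (E⁄F).a₁ * s + (E⁄F).a₃ = 0) :
    3 * s ^ 2 + 2 * (E⁄F).a₂ * s + (E⁄F).a₄ - (E⁄F).a₁ * t ≠ 0 := by
  intro hC
  rcases ((nonsingular_iff' ..).mp h).2 with h | h
  · exact h (by linear_combination -hC)
  · exact h hB

/-- Now `B = 0`, so nonsingularity gives `C ≠ 0`, and the order is computed from `2 - 4`. -/
lemma vAt_x_sub_of_eq {s t : F} (h : (E⁄F).Nonsingular s t)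
    (hB : 2 * t + (E⁄F).a₁ * s + (E⁄F).a₃ = 0) :
    D.vAt (.some s t h) (D.x - algebraMap F M s) = exp (-2) := by
  have h1 := congrArg D.v (D.translation_x_y h _ _ _ rfl rfl rfl).1
  rw [vAt_apply, map_sub, AlgHom.commutes]
  rw [hB, map_zero, zero_mul, sub_zero, map_mul, map_pow, map_mul, v_x_sub,
    D.v_const _ (nonsingular_coeff h hB), one_mul, ← exp_nsmul] at h1
  rw [mul_exp_eq h1]
  rfl

/-- With `B = 0` the term `C (x - s)(y - t)` dominates, with pole order 5 against 6 for `(x - s) ^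
3`. -/
lemma vAt_y_sub_of_eq {s t : F} (h : (E⁄F).Nonsingular s t)
    (hB : 2 * t + (E⁄F).a₁ * s + (E⁄F).a₃ = 0) :
    D.vAt (.some s t h) (D.y - algebraMap F M t) = exp (-1) := by
  have h1 := congrArg D.v (D.translation_x_y h _ _ _ rfl rfl rfl).2
  have hC := nonsingular_coeff h hB
  rw [vAt_apply, map_sub, AlgHom.commutes]
  rw [hB, map_zero] at h1
  rw [show ∀ a b c d : M, 0 * a * c ^ 2 + 0 * d * c - 0 ^ 2 * b - d * c * b -
    algebraMap F M (E⁄F).a₁ * d * c ^ 2 = (-d) * (c * (b + algebraMap F M (E⁄F).a₁ * c)) by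
    intros; ring] at h1
  rw [map_mul, map_mul, map_mul, map_pow, Valuation.map_neg, v_x_sub, D.v_const _ hC, one_mul,
    Valuation.map_add_eq_of_lt_left, v_y_sub, ← exp_nsmul, ← exp_add] at h1
  · rw [mul_exp_eq h1]
    rfl
  · rw [map_mul, v_x_sub, v_y_sub]
    refine lt_of_le_of_lt (mul_le_of_le_one_left' (D.isInfty_v.const_le _)) ?_
    rw [exp_lt_exp]; norm_num

lemma vAt_x_sub_lt {s t : F} (h : (E⁄F).Nonsingular s t) :
    D.vAt (.some s t h) (D.x - algebraMap F M s) < 1 := by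
  by_cases hB : 2 * t + (E⁄F).a₁ * s + (E⁄F).a₃ = 0
  · rw [D.vAt_x_sub_of_eq h hB, ← exp_zero, exp_lt_exp]; norm_num
  · rw [D.vAt_x_sub_of_ne h hB, ← exp_zero, exp_lt_exp]; norm_num

lemma vAt_y_sub_lt {s t : F} (h : (E⁄F).Nonsingular s t) :
    D.vAt (.some s t h) (D.y - algebraMap F M t) < 1 := by
  have h1 := congrArg D.v (D.translation_x_y h _ _ _ rfl rfl rfl).2
  rw [vAt_apply, map_sub, AlgHom.commutes]
  -- Every term on the right has pole order at most 5, while `(x - s) ^ 3` has 6.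
  have h2 : D.v ((D.translation (.some s t h) D.y - algebraMap F M t) *
      (D.x - algebraMap F M s) ^ 3) ≤ exp 5 := by
    rw [h1]
    have e (c : F) {a : ℤᵐ⁰} (n : ℤ) (ha : a = exp n) (hn : n ≤ 5) :
        D.v (algebraMap F M c) * a ≤ exp 5 :=
      (mul_le_of_le_one_left' (D.isInfty_v.const_le _)).trans
        (ha.trans_le (exp_le_exp.mpr hn))
    refine Valuation.map_sub_le _ (Valuation.map_sub_le _ (Valuation.map_sub_le _
      (Valuation.map_add_le _ ?_ ?_) ?_) ?_) ?_
    · rw [← map_mul, map_mul D.v]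
      exact e _ 4 (by rw [map_pow, v_x_sub]; rfl) (by norm_num)
    · rw [← map_mul, map_mul D.v]
      exact e _ 2 (D.v_x_sub s) (by norm_num)
    · rw [← map_pow, map_mul D.v]
      exact e _ 3 (D.v_y_sub t) (by norm_num)
    · rw [mul_assoc, map_mul D.v]
      exact e _ 5 (by rw [map_mul, v_x_sub, v_y_sub]; rfl) (by norm_num)
    · rw [← map_mul, map_mul D.v]
      exact e _ 4 (by rw [map_pow, v_x_sub]; rfl) (by norm_num)
  rw [map_mul, map_pow, v_x_sub] at h2
  by_contra hcon
  have h3 := (le_mul_of_one_le_left' (not_lt.mp hcon) (a := exp (2 : ℤ) ^ 3)).trans h2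
  rw [← exp_nsmul, exp_le_exp] at h3
  norm_num at h3

lemma vAt_x_le {s t : F} (h : (E⁄F).Nonsingular s t) : D.vAt (.some s t h) D.x ≤ 1 := by
  rw [← sub_add_cancel D.x (algebraMap F M s)]
  exact Valuation.map_add_le _ (D.vAt_x_sub_lt h).le (D.vAt_const_le _ _)

lemma vAt_y_le {s t : F} (h : (E⁄F).Nonsingular s t) : D.vAt (.some s t h) D.y ≤ 1 := by
  rw [← sub_add_cancel D.y (algebraMap F M t)]
  exact Valuation.map_add_le _ (D.vAt_y_sub_lt h).le (D.vAt_const_le _ _)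

lemma vAt_aeval_sub_lt {s t : F} (h : (E⁄F).Nonsingular s t) (p : F[X]) :
    D.vAt (.some s t h) (aeval D.x p - algebraMap F M (p.eval s)) < 1 := by
  have hd : (X - C s) ∣ p - C (p.eval s) := by
    rw [dvd_iff_isRoot]; simp
  obtain ⟨q, hq⟩ := hd
  have e := congrArg (aeval D.x) hq
  rw [map_sub, aeval_C, map_mul, map_sub, aeval_X, aeval_C] at e
  rw [e, map_mul]
  have hq1 : D.vAt (.some s t h) (aeval D.x q) ≤ 1 := by
    rw [aeval_eq_sum_range]
    refine Valuation.map_sum_le _ fun i _ => ?_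
    rw [Algebra.smul_def, map_mul, map_pow]
    exact mul_le_one' (D.vAt_const_le _ _) (pow_le_one' (D.vAt_x_le h) _)
  exact lt_of_le_of_lt (mul_le_of_le_one_right' hq1) (D.vAt_x_sub_lt h)

lemma vAt_aeval_le {s t : F} (h : (E⁄F).Nonsingular s t) (p : F[X]) :
    D.vAt (.some s t h) (aeval D.x p) ≤ 1 := by
  rw [← sub_add_cancel (aeval D.x p) (algebraMap F M (p.eval s))]
  exact Valuation.map_add_le _ (D.vAt_aeval_sub_lt h p).le (D.vAt_const_le _ _)

lemma vAt_aeval_add_mul_y_sub_lt {s t : F} (h : (E⁄F).Nonsingular s t) (p q : F[X]) :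
    D.vAt (.some s t h) (aeval D.x p + aeval D.x q * D.y -
      algebraMap F M (p.eval s + q.eval s * t)) < 1 := by
  have e : aeval D.x p + aeval D.x q * D.y - algebraMap F M (p.eval s + q.eval s * t) =
      (aeval D.x p - algebraMap F M (p.eval s)) +
      ((aeval D.x q - algebraMap F M (q.eval s)) * D.y +
        algebraMap F M (q.eval s) * (D.y - algebraMap F M t)) := by
    rw [map_add, map_mul]; ring
  rw [e]
  refine Valuation.map_add_lt _ (D.vAt_aeval_sub_lt h p) (Valuation.map_add_lt _ ?_ ?_)
  · rw [map_mul]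
    exact lt_of_le_of_lt (mul_le_of_le_one_right' (D.vAt_y_le h)) (D.vAt_aeval_sub_lt h q)
  · rw [map_mul]
    exact lt_of_le_of_lt (mul_le_of_le_one_left' (D.vAt_const_le _ _)) (D.vAt_y_sub_lt h)

lemma vAt_aeval_add_mul_y_le {s t : F} (h : (E⁄F).Nonsingular s t) (p q : F[X]) :
    D.vAt (.some s t h) (aeval D.x p + aeval D.x q * D.y) ≤ 1 := by
  refine Valuation.map_add_le _ (D.vAt_aeval_le h p) ?_
  rw [map_mul]
  exact mul_le_one' (D.vAt_aeval_le h q) (D.vAt_y_le h)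

/-- A regular function differs from its value at the point by something of valuation below `1`, and
a nonzero constant has valuation exactly `1`. -/
lemma vAt_lt_one_iff {s t : F} (h : (E⁄F).Nonsingular s t) (p q : F[X]) :
    D.vAt (.some s t h) (aeval D.x p + aeval D.x q * D.y) < 1 ↔ p.eval s + q.eval s * t = 0 := by
  have h1 := D.vAt_aeval_add_mul_y_sub_lt h p q
  constructor
  · intro h2
    by_contra hc
    have h3 := Valuation.map_sub_lt _ h2 h1
    rw [sub_sub_cancel, D.vAt_const _ hc] at h3
    exact lt_irrefl _ h3
  · intro h2
    rwa [h2, map_zero, sub_zero] at h1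

end Local

/-! ### Divisors, and functions without poles. -/

section Divisor

variable {K F M : Type*} [Field K] {E : Affine K} [E.IsElliptic] [Field F] [Field M]
  [Algebra K F] [Algebra F M] [Algebra K M] [IsScalarTower K F M] [IsAlgClosed F]
  [DecidableEq F] [DecidableEq M] (D : FunctionFieldModel E F M)

variable (E) in
lemma exists_nonsingular (s : F) : ∃ t, (E⁄F).Nonsingular s t := by
  have hq : (X ^ 2 + C ((E⁄F).a₁ * s + (E⁄F).a₃) * X -
      C (s ^ 3 + (E⁄F).a₂ * s ^ 2 + (E⁄F).a₄ * s + (E⁄F).a₆)).degree = 2 := by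
    compute_degree!
  obtain ⟨t, ht⟩ := IsAlgClosed.exists_root _ (by rw [hq]; norm_num)
  refine ⟨t, equation_iff_nonsingular.mp ((equation_iff ..).mpr ?_)⟩
  simp only [IsRoot.def, eval_sub, eval_add, eval_mul, eval_pow, eval_X, eval_C] at ht
  linear_combination ht

lemma vAt_aeval_sub_le {s t : F} (h : (E⁄F).Nonsingular s t) (p : F[X]) :
    D.vAt (.some s t h) (aeval D.x p - algebraMap F M (p.eval s)) ≤
      D.vAt (.some s t h) (D.x - algebraMap F M s) := by
  have hd : (X - C s) ∣ p - C (p.eval s) := by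
    rw [dvd_iff_isRoot]; simp
  obtain ⟨q, hq⟩ := hd
  have e := congrArg (aeval D.x) hq
  rw [map_sub, aeval_C, map_mul, map_sub, aeval_X, aeval_C] at e
  rw [e, map_mul]
  exact mul_le_of_le_one_right' (D.vAt_aeval_le h q)

/-- Local form of the integral closedness of `F[x, y]`. If two points lie above `s`, vanishing at
both kills `p(s)` and `q(s)`; if only one does, `x - s` vanishes there doubly but `y - t` simply,
which excludes `q(s) ≠ 0`. -/
lemma eval_eq_zero_of_vAt_le {p q : F[X]} {s : F}
    (hle : ∀ t (h : (E⁄F).Nonsingular s t), D.vAt (.some s t h) (aeval D.x p + aeval D.x q * D.y) ≤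
      D.vAt (.some s t h) (D.x - algebraMap F M s)) : p.eval s = 0 ∧ q.eval s = 0 := by
  obtain ⟨t, h⟩ := exists_nonsingular E s
  have h1 := (D.vAt_lt_one_iff h p q).mp ((hle t h).trans_lt (D.vAt_x_sub_lt h))
  suffices hq : q.eval s = 0 by
    rw [hq, zero_mul, add_zero] at h1
    exact ⟨h1, hq⟩
  by_cases hB : 2 * t + (E⁄F).a₁ * s + (E⁄F).a₃ = 0
  · by_contra hq
    have e : algebraMap F M (q.eval s) * (D.y - algebraMap F M t) =
        (aeval D.x p + aeval D.x q * D.y) - (aeval D.x p - algebraMap F M (p.eval s)) -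
          (aeval D.x q - algebraMap F M (q.eval s)) * D.y := by
      have : algebraMap F M (p.eval s) = -(algebraMap F M (q.eval s) * algebraMap F M t) := by
        rw [← map_mul, ← map_neg]; congr 1; linear_combination h1
      rw [this]; ring
    have h2 : D.vAt (.some s t h) (algebraMap F M (q.eval s) * (D.y - algebraMap F M t)) ≤
        D.vAt (.some s t h) (D.x - algebraMap F M s) := by
      rw [e]
      refine Valuation.map_sub_le _ (Valuation.map_sub_le _ (hle t h) (D.vAt_aeval_sub_le h p)) ?_
      rw [map_mul]
      exact (mul_le_of_le_one_right' (D.vAt_y_le h)).trans (D.vAt_aeval_sub_le h q)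
    rw [map_mul, D.vAt_const _ hq, one_mul, D.vAt_y_sub_of_eq h hB, D.vAt_x_sub_of_eq h hB,
      exp_le_exp] at h2
    norm_num at h2
  · have h' := (nonsingular_neg s t).mpr h
    have h2 := (D.vAt_lt_one_iff h' p q).mp ((hle _ h').trans_lt (D.vAt_x_sub_lt h'))
    rw [negY] at h2
    have h3 : q.eval s * (2 * t + (E⁄F).a₁ * s + (E⁄F).a₃) = 0 := by
      linear_combination h1 - h2
    exact (mul_eq_zero.mp h3).resolve_right hB

/-- The linear factors of a polynomial denominator are cancelled one at a time by
`eval_eq_zero_of_vAt_le`. -/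
lemma exists_eq_aeval_of_vAt_le {f : M} (hf : ∀ s t h, D.vAt (.some s t h) f ≤ 1) :
    ∃ p q : F[X], f = aeval D.x p + aeval D.x q * D.y := by
  obtain ⟨p, q, r, hr, e⟩ := D.exists_mul_eq f
  induction hn : r.natDegree generalizing p q r with
  | zero =>
    obtain ⟨c, rfl⟩ := natDegree_eq_zero.mp hn
    have hc : c ≠ 0 := by simpa using hr
    refine ⟨C c⁻¹ * p, C c⁻¹ * q, ?_⟩
    rw [map_mul, map_mul, aeval_C, mul_assoc, ← mul_add, ← e, aeval_C, map_inv₀]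
    have : algebraMap F M c ≠ 0 := by simpa using hc
    field_simp
  | succ n ih =>
    obtain ⟨s, hs⟩ := IsAlgClosed.exists_root r (by
      rw [degree_eq_natDegree hr, hn]; exact_mod_cast Nat.succ_ne_zero n)
    obtain ⟨r', rfl⟩ := dvd_iff_isRoot.mpr hs
    have h0 := D.eval_eq_zero_of_vAt_le (p := p) (q := q) (s := s) (by
      intro t h
      rw [← e, map_mul, map_mul, map_mul, map_sub, aeval_X, aeval_C, mul_left_comm]
      exact mul_le_of_le_one_right' (mul_le_one' (hf s t h) (D.vAt_aeval_le h r')))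
    obtain ⟨p', rfl⟩ := dvd_iff_isRoot.mpr h0.1
    obtain ⟨q', rfl⟩ := dvd_iff_isRoot.mpr h0.2
    refine ih p' q' r' (right_ne_zero_of_mul hr) ?_ ?_
    · have hx := D.x_sub_ne_zero s
      simp only [map_mul, map_sub, aeval_X, aeval_C] at e
      refine mul_left_cancel₀ hx ?_
      linear_combination e
    · rw [natDegree_mul (X_sub_C_ne_zero s) (right_ne_zero_of_mul hr), natDegree_X_sub_C] at hn
      omega

/-- Regularity at affine points gives `p + q y`; at infinity the pole orders `2 deg p` and `2 deg q
+ 3` leave only constants. -/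
lemma exists_eq_algebraMap_of_vAt_le {f : M} (hf : ∀ S, D.vAt S f ≤ 1) :
    ∃ c : F, f = algebraMap F M c := by
  obtain ⟨p, q, rfl⟩ := D.exists_eq_aeval_of_vAt_le (fun s t h => hf _)
  have h0 := hf 0
  rw [vAt_zero, D.isInfty_v.add_eq_max, max_le_iff] at h0
  have hq : q = 0 := by
    by_contra hq
    have := h0.2
    rw [D.isInfty_v.aeval_mul_y hq, ← exp_zero, exp_le_exp] at this
    omega
  have hp : p.natDegree = 0 := by
    by_cases hp : p = 0
    · simp [hp]
    have := h0.1
    rw [D.isInfty_v.aeval hp, ← exp_zero, exp_le_exp] at this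
    omega
  obtain ⟨c, rfl⟩ := natDegree_eq_zero.mp hp
  exact ⟨c, by rw [hq, aeval_C]; simp⟩

/-- The divisor of a function, as a function on points. -/
noncomputable def div (f : M) (S : (E⁄F).Point) : ℤ := -log (D.vAt S f)

lemma vAt_ne_zero (S : (E⁄F).Point) {f : M} (hf : f ≠ 0) : D.vAt S f ≠ 0 :=
  (Valuation.ne_zero_iff _).mpr hf

lemma vAt_eq_exp (S : (E⁄F).Point) {f : M} (hf : f ≠ 0) : D.vAt S f = exp (-D.div f S) := by
  rw [div, neg_neg, exp_log (D.vAt_ne_zero S hf)]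

lemma div_eq_iff (S : (E⁄F).Point) {f : M} (hf : f ≠ 0) (n : ℤ) :
    D.div f S = n ↔ D.vAt S f = exp (-n) := by
  rw [D.vAt_eq_exp S hf, exp_inj, neg_inj]

lemma div_mul {f g : M} (hf : f ≠ 0) (hg : g ≠ 0) : D.div (f * g) = D.div f + D.div g := by
  ext S
  rw [Pi.add_apply, div, map_mul, log_mul (D.vAt_ne_zero S hf) (D.vAt_ne_zero S hg), div, div]
  ring

lemma div_inv (f : M) : D.div f⁻¹ = -D.div f := by
  ext S
  rw [Pi.neg_apply, div, map_inv₀, log_inv, div]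

lemma div_div {f g : M} (hf : f ≠ 0) (hg : g ≠ 0) : D.div (f / g) = D.div f - D.div g := by
  rw [div_eq_mul_inv, D.div_mul hf (inv_ne_zero hg), div_inv, sub_eq_add_neg]

lemma div_zpow (f : M) (n : ℤ) : D.div (f ^ n) = n • D.div f := by
  ext S
  rw [Pi.smul_apply, div, map_zpow₀, log_zpow, div, smul_neg]

lemma div_algebraMap {c : F} (hc : c ≠ 0) : D.div (algebraMap F M c) = 0 := by
  ext S
  rw [div, D.vAt_const S hc, log_one]; rfl

lemma div_one : D.div 1 = 0 := by
  have := D.div_algebraMap (c := 1) one_ne_zero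
  rwa [map_one] at this

lemma div_neg (f : M) : D.div (-f) = D.div f := by
  ext S
  rw [div, Valuation.map_neg, div]

lemma div_translation (f : M) (T S : (E⁄F).Point) :
    D.div (D.translation T f) S = D.div f (S + T) := by
  rw [div, vAt_translation, div]

lemma div_nonneg_iff (S : (E⁄F).Point) {f : M} (hf : f ≠ 0) : 0 ≤ D.div f S ↔ D.vAt S f ≤ 1 := by
  rw [D.vAt_eq_exp S hf, ← exp_zero, exp_le_exp]
  omega

lemma div_pos_iff (S : (E⁄F).Point) {f : M} (hf : f ≠ 0) : 0 < D.div f S ↔ D.vAt S f < 1 := by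
  rw [D.vAt_eq_exp S hf, ← exp_zero, exp_lt_exp]
  omega

lemma exists_eq_algebraMap_of_div_nonneg {f : M} (hf : f ≠ 0) (h : ∀ S, 0 ≤ D.div f S) :
    ∃ c : F, c ≠ 0 ∧ f = algebraMap F M c := by
  obtain ⟨c, rfl⟩ := D.exists_eq_algebraMap_of_vAt_le fun S => (D.div_nonneg_iff S hf).mp (h S)
  exact ⟨c, by rintro rfl; simp at hf, rfl⟩

lemma exists_algebraMap_mul_eq {f g : M} (hf : f ≠ 0) (hg : g ≠ 0) (h : D.div f = D.div g) :
    ∃ c : F, c ≠ 0 ∧ f = algebraMap F M c * g := by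
  obtain ⟨c, hc, e⟩ := D.exists_eq_algebraMap_of_div_nonneg (div_ne_zero hf hg) (fun S => by
    rw [D.div_div hf hg, h, sub_self]; rfl)
  exact ⟨c, hc, by rw [← e, div_mul_cancel₀ _ hg]⟩

/-- The divisor of a point. -/
noncomputable def δ (A : (E⁄F).Point) : (E⁄F).Point → ℤ := fun S => if S = A then 1 else 0

lemma div_x_sub {s t : F} (h : (E⁄F).Nonsingular s t) :
    D.div (D.x - algebraMap F M s) = δ (.some s t h) + δ (-.some s t h) - 2 • δ 0 := by
  ext S
  simp only [Pi.add_apply, Pi.sub_apply, Pi.smul_apply, δ]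
  rw [D.div_eq_iff _ (D.x_sub_ne_zero s)]
  rcases S with _ | ⟨a, b, hab⟩
  · rw [← Point.zero_def, vAt_zero, v_x_sub, if_neg (Point.some_ne_zero h).symm,
      if_neg (by rw [eq_comm, neg_eq_zero]; exact Point.some_ne_zero h), if_pos rfl]
    rfl
  rw [if_neg (Point.some_ne_zero hab), smul_zero, sub_zero]
  by_cases ha : a = s
  · subst ha
    have hor := (Point.X_eq_iff (h₁ := hab) (h₂ := h)).mp rfl
    -- For a 2-torsion point the two deltas coincide and add up to the double zero.
    by_cases hB : 2 * t + (E⁄F).a₁ * a + (E⁄F).a₃ = 0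
    · have hneg : -Point.some a t h = .some a t h := by
        rw [Point.neg_some, Point.some.injEq]
        exact ⟨rfl, by rw [negY]; linear_combination -hB⟩
      rw [hneg, or_self] at hor
      rw [hneg, hor, if_pos rfl, D.vAt_x_sub_of_eq h hB]
      rfl
    · have hneg : Point.some a t h ≠ -.some a t h := by
        rw [Point.neg_some, Ne, Point.some.injEq, negY]
        rintro ⟨-, h1⟩
        exact hB (by linear_combination h1)
      rcases hor with hor | hor
      · rw [hor, if_pos rfl, if_neg hneg, D.vAt_x_sub_of_ne h hB]
        rfl
      · rw [hor, if_pos rfl, if_neg hneg.symm, Point.neg_some, D.vAt_x_sub_of_ne]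
        · rfl
        · rw [negY]
          contrapose hB
          linear_combination -hB
  · rw [if_neg, if_neg]
    · have e : D.x - algebraMap F M s = (D.x - algebraMap F M a) + algebraMap F M (a - s) := by
        rw [map_sub]; ring
      rw [e, Valuation.map_add_eq_of_lt_right, D.vAt_const _ (sub_ne_zero.mpr ha)]
      · rfl
      · rw [D.vAt_const _ (sub_ne_zero.mpr ha)]
        exact D.vAt_x_sub_lt hab
    · rw [Point.neg_some, Point.some.injEq]; exact fun h => ha h.1
    · rw [Point.some.injEq]; exact fun h => ha h.1

end Divisor

/-! ### Negation on the function field, and degree zero of principal divisors. -/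

section Degree

variable {K F M : Type*} [Field K] {E : Affine K} [E.IsElliptic] [Field F] [Field M]
  [Algebra K F] [Algebra F M] [Algebra K M] [IsScalarTower K F M] [IsAlgClosed F]
  [DecidableEq F] [DecidableEq M] (D : FunctionFieldModel E F M)

lemma exists_negation : ∃ f : M →ₐ[F] M, f D.x = D.x ∧
    f D.y = -D.y - algebraMap F M (E⁄F).a₁ * D.x - algebraMap F M (E⁄F).a₃ := by
  obtain ⟨e1, -, e3, -⟩ := algebraMap_coeff (E := E) (F := F) (M := M)
  obtain ⟨f, hf, hx, hy⟩ := D.exists_lift (IsScalarTower.toAlgHom K F M) D.x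
    ((E⁄M).negY D.x D.y) ((equation_neg ..).mpr D.equation) (fun p hp => aeval_ne_zero hp)
  exact ⟨{ f with commutes' := hf }, hx, by rw [← e1, ← e3]; exact hy⟩

/-- Negation on the function field. -/
noncomputable def negation : M →ₐ[F] M := D.exists_negation.choose

lemma negation_x : D.negation D.x = D.x := D.exists_negation.choose_spec.1

lemma negation_y : D.negation D.y =
    -D.y - algebraMap F M (E⁄F).a₁ * D.x - algebraMap F M (E⁄F).a₃ :=
  D.exists_negation.choose_spec.2

lemma negation_aeval (p : F[X]) : D.negation (aeval D.x p) = aeval D.x p := by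
  rw [← aeval_algHom_apply, negation_x]

lemma map_negation_generic : Point.map (W' := E) D.negation D.generic = -D.generic := by
  obtain ⟨e1, -, e3, -⟩ := algebraMap_coeff (E := E) (F := F) (M := M)
  rw [generic, Point.map_some, Point.neg_some, Point.some.injEq]
  refine ⟨D.negation_x, ?_⟩
  rw [negY, e1, e3]
  exact D.negation_y

lemma v_negation (f : M) : D.v (D.negation f) = D.v f := by
  have : D.IsInfty (D.v.comap (D.negation : M →+* M)) := by
    refine ⟨fun c hc => ?_, ?_, ?_⟩
    · rw [Valuation.comap_apply, RingHom.coe_coe, AlgHom.commutes, D.v_const c hc]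
    · rw [Valuation.comap_apply, RingHom.coe_coe, negation_x, D.v_x]
    · rw [Valuation.comap_apply, RingHom.coe_coe, negation_y, sub_sub, ← neg_add',
        Valuation.map_neg]
      have := D.v_add_mul_y 1 one_ne_zero (C (E⁄F).a₁ * X + C (E⁄F).a₃) (by compute_degree)
      rw [map_add (aeval D.x), map_mul (aeval D.x), aeval_C, aeval_C, aeval_X,
        map_one (algebraMap F M), one_mul] at this
      rw [← this]
      congr 1
      ring
  exact congr($(this.eq D.isInfty_v) f)

lemma translation_negation (S : (E⁄F).Point) (f : M) :
    D.translation S (D.negation f) = D.negation (D.translation (-S) f) := by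
  have : (D.translation S).comp D.negation = D.negation.comp (D.translation (-S)) := by
    apply D.algHom_eq'
    rw [← Point.map_map, ← Point.map_map, map_negation_generic, map_translation_generic, map_neg,
      map_add, map_translation_generic, map_constPoint, map_negation_generic, neg_add]
    congr 1
    exact (map_neg (Point.baseChange (W' := E) F M) S).symm
  exact congr($this f)

lemma div_negation (f : M) (S : (E⁄F).Point) : D.div (D.negation f) S = D.div f (-S) := by
  rw [div, vAt_apply, translation_negation, v_negation]; rfl

/-- `N` is the norm to `F[x]`. Its roots bound the zeros of `p + q y`, and the product formula
transfers degree computations to polynomials in `x`. -/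
lemma exists_mul_negation (p q : F[X]) : ∃ N : F[X],
    (aeval D.x p + aeval D.x q * D.y) * D.negation (aeval D.x p + aeval D.x q * D.y) =
      aeval D.x N ∧ ∀ s t, (E⁄F).Equation s t → p.eval s + q.eval s * t = 0 → N.eval s = 0 := by
  obtain ⟨e1, e2, e3, e4, e6⟩ := algebraMap_coeff (E := E) (F := F) (M := M)
  refine ⟨p ^ 2 - p * q * (C (E⁄F).a₁ * X + C (E⁄F).a₃) -
      q ^ 2 * (X ^ 3 + C (E⁄F).a₂ * X ^ 2 + C (E⁄F).a₄ * X + C (E⁄F).a₆), ?_, ?_⟩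
  · have h := (equation_iff ..).mp D.equation
    rw [e1, e2, e3, e4, e6] at h
    simp only [map_add, map_mul, map_sub, map_pow, aeval_X, aeval_C, negation_aeval, negation_y]
    linear_combination -(aeval D.x q) ^ 2 * h
  · intro s t hst h
    have hst := (equation_iff ..).mp hst
    simp only [eval_add, eval_mul, eval_sub, eval_pow, eval_X, eval_C]
    linear_combination (p.eval s - q.eval s * ((E⁄F).a₁ * s + (E⁄F).a₃) - q.eval s * t) * h
      + (q.eval s) ^ 2 * hst

lemma finite_setOf_x_eq (s : F) : {S : (E⁄F).Point | ∃ t h, S = .some s t h}.Finite := by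
  obtain ⟨t, h⟩ := exists_nonsingular E s
  refine Set.Finite.subset (Set.toFinite {.some s t h, -.some s t h}) ?_
  rintro S ⟨t', h', rfl⟩
  exact (Point.X_eq_iff (h₁ := h') (h₂ := h)).mp rfl

lemma finite_support_aeval {p q : F[X]} (h0 : aeval D.x p + aeval D.x q * D.y ≠ 0) :
    (Function.support (D.div (aeval D.x p + aeval D.x q * D.y))).Finite := by
  obtain ⟨N, hN, hroot⟩ := D.exists_mul_negation p q
  have hN0 : N ≠ 0 := by
    rintro rfl
    rw [map_zero, mul_eq_zero, map_eq_zero, or_self] at hN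
    exact h0 hN
  refine Set.Finite.subset ((Set.finite_singleton 0).union
    (N.rootSet_finite F |>.biUnion fun s _ => finite_setOf_x_eq (E := E) s)) ?_
  rintro (_ | ⟨s, t, h⟩) hS
  · exact .inl rfl
  · right
    refine Set.mem_biUnion (x := s) ?_ ⟨t, h, rfl⟩
    rw [mem_rootSet_of_ne hN0, coe_aeval_eq_eval]
    apply hroot s t h.1
    rw [← D.vAt_lt_one_iff h p q, ← D.div_pos_iff _ h0]
    exact lt_of_le_of_ne ((D.div_nonneg_iff _ h0).mpr (D.vAt_aeval_add_mul_y_le h p q))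
      (Ne.symm hS)

lemma finite_support_div {f : M} (hf : f ≠ 0) : (Function.support (D.div f)).Finite := by
  obtain ⟨p, q, h, hh, e⟩ := D.exists_mul_eq f
  have hh' := aeval_ne_zero (D := D) hh
  have h1 := D.div_mul hf hh'
  have h2 : aeval D.x h = aeval D.x h + aeval D.x (0 : F[X]) * D.y := by simp
  rw [e] at h1
  rw [show D.div f = D.div (aeval D.x p + aeval D.x q * D.y) - D.div (aeval D.x h) by
    rw [h1, add_sub_cancel_right]]
  have h3 := D.finite_support_aeval (p := p) (q := q) (by rw [← e]; exact mul_ne_zero hf hh')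
  have h4 := D.finite_support_aeval (p := h) (q := 0) (by rwa [← h2])
  rw [← h2] at h4
  exact (h3.union h4).subset (Function.support_sub _ _)

lemma finsum_δ (A : (E⁄F).Point) : ∑ᶠ S, δ A S = 1 := by
  rw [finsum_eq_single (δ A) A (fun S hS => if_neg hS)]
  exact if_pos rfl

lemma finite_support_δ (A : (E⁄F).Point) : (Function.support (δ A)).Finite :=
  (Set.finite_singleton A).subset fun S hS => by
    by_contra h
    exact hS (if_neg h)

lemma finsum_div_mul {f g : M} (hf : f ≠ 0) (hg : g ≠ 0) :
    ∑ᶠ S, D.div (f * g) S = ∑ᶠ S, D.div f S + ∑ᶠ S, D.div g S := by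
  rw [D.div_mul hf hg]
  exact finsum_add_distrib (D.finite_support_div hf) (D.finite_support_div hg)

lemma finsum_div_algebraMap {c : F} (hc : c ≠ 0) : ∑ᶠ S, D.div (algebraMap F M c) S = 0 := by
  rw [D.div_algebraMap hc]
  exact finsum_zero

lemma finsum_div_x_sub (s : F) : ∑ᶠ S, D.div (D.x - algebraMap F M s) S = 0 := by
  obtain ⟨t, h⟩ := exists_nonsingular E s
  have e : (δ (.some s t h) + δ (-.some s t h) : (E⁄F).Point → ℤ) =
      D.div (D.x - algebraMap F M s) + (δ 0 + δ 0) := by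
    rw [D.div_x_sub h, two_nsmul, sub_add_cancel]
  have h0 := finite_support_δ (0 : (E⁄F).Point)
  have h1 : (Function.support (δ 0 + δ 0 : (E⁄F).Point → ℤ)).Finite :=
    (h0.union h0).subset (Function.support_add _ _)
  have h2 : ∑ᶠ S, (δ (.some s t h) S + δ (-.some s t h) S) =
      ∑ᶠ S, (D.div (D.x - algebraMap F M s) S + (δ 0 + δ 0 : (E⁄F).Point → ℤ) S) :=
    finsum_congr (congrFun e)
  have h3 : ∑ᶠ S, (δ 0 + δ 0 : (E⁄F).Point → ℤ) S = _ := finsum_add_distrib h0 h0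
  rw [finsum_add_distrib (finite_support_δ _) (finite_support_δ _),
    finsum_add_distrib (D.finite_support_div (D.x_sub_ne_zero s)) h1, h3,
    finsum_δ, finsum_δ, finsum_δ] at h2
  omega

lemma finsum_div_aeval {p : F[X]} (hp : p ≠ 0) : ∑ᶠ S, D.div (aeval D.x p) S = 0 := by
  induction hn : p.natDegree generalizing p with
  | zero =>
    obtain ⟨c, rfl⟩ := natDegree_eq_zero.mp hn
    rw [aeval_C]
    exact D.finsum_div_algebraMap (by simpa using hp)
  | succ n ih =>
    obtain ⟨s, hs⟩ := IsAlgClosed.exists_root p (by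
      rw [degree_eq_natDegree hp, hn]; exact_mod_cast Nat.succ_ne_zero n)
    obtain ⟨r, rfl⟩ := dvd_iff_isRoot.mpr hs
    have hr := right_ne_zero_of_mul hp
    rw [natDegree_mul (X_sub_C_ne_zero s) hr, natDegree_X_sub_C] at hn
    rw [map_mul, map_sub, aeval_X, aeval_C,
      D.finsum_div_mul (D.x_sub_ne_zero s) (aeval_ne_zero hr), finsum_div_x_sub,
      ih hr (by omega), add_zero]

lemma finsum_div_negation (f : M) : ∑ᶠ S, D.div (D.negation f) S = ∑ᶠ S, D.div f S := by
  simp only [div_negation]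
  exact finsum_comp_equiv (Equiv.neg (E⁄F).Point)

/-- The divisor of a function has degree zero. -/
theorem finsum_div {f : M} (hf : f ≠ 0) : ∑ᶠ S, D.div f S = 0 := by
  obtain ⟨p, q, h, hh, e⟩ := D.exists_mul_eq f
  have hh' := aeval_ne_zero (D := D) hh
  obtain ⟨N, hN, -⟩ := D.exists_mul_negation p q
  have hr : aeval D.x p + aeval D.x q * D.y ≠ 0 := e ▸ mul_ne_zero hf hh'
  have hμ : D.negation (aeval D.x p + aeval D.x q * D.y) ≠ 0 := (_root_.map_ne_zero _).mpr hr
  -- Negation preserves degree, so twice the degree of the numerator is the degree of `N(x)`, which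
  -- is zero.
  have h1 := D.finsum_div_mul hr hμ
  rw [hN, finsum_div_negation, D.finsum_div_aeval] at h1
  · have h2 := D.finsum_div_mul hf hh'
    rw [e, D.finsum_div_aeval hh] at h2
    omega
  · rintro rfl
    rw [map_zero] at hN
    exact mul_ne_zero hr hμ hN

end Degree

/-! ### Lines, and the principal divisors coming from the group law. -/

section Line

variable {K F M : Type*} [Field K] {E : Affine K} [E.IsElliptic] [Field F] [Field M]
  [Algebra K F] [Algebra F M] [Algebra K M] [IsScalarTower K F M] [IsAlgClosed F]
  [DecidableEq F] [DecidableEq M] (D : FunctionFieldModel E F M)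

lemma δ_neg (A S : (E⁄F).Point) : δ A (-S) = δ (-A) S := by
  simp only [δ, neg_eq_iff_eq_neg]

lemma δ_zero_some {s t : F} (h : (E⁄F).Nonsingular s t) : δ 0 (Point.some s t h) = 0 :=
  if_neg (Point.some_ne_zero h)

/-- With `l = y - P(x)`, the product of `l` and its negation is `-(x - x₁)(x - x₂)(x - x₃)`, which
gives `div l` summed over `S` and `-S`. This determines `div l S` when `S = -S`; otherwise `l`
vanishes at no more than one of the two points. -/
lemma exists_line {x₁ y₁ x₂ y₂ : F} (h₁ : (E⁄F).Nonsingular x₁ y₁) (h₂ : (E⁄F).Nonsingular x₂ y₂)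
    (hxy : ¬(x₁ = x₂ ∧ y₁ = (E⁄F).negY x₂ y₂)) :
    ∃ l : M, l ≠ 0 ∧ D.div l = δ (.some x₁ y₁ h₁) + δ (.some x₂ y₂ h₂) +
      δ (-(.some x₁ y₁ h₁ + .some x₂ y₂ h₂)) - 3 • δ 0 := by
  set L := (E⁄F).slope x₁ x₂ y₁ y₂ with hL
  set P : F[X] := linePolynomial x₁ y₁ L with hP
  set l : M := aeval D.x (-P) + aeval D.x (1 : F[X]) * D.y with hl
  have hPe (a : F) : P.eval a = L * (a - x₁) + y₁ := by
    simp [hP, linePolynomial]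
  have hl0 : l ≠ 0 := by
    intro h
    have h1 := D.isInfty_v.add_eq_max (-P) 1
    have h2 := D.isInfty_v.aeval_mul_y (one_ne_zero (α := F[X]))
    rw [← hl, h, map_zero, h2] at h1
    exact absurd (le_max_right _ _) (not_le.mpr (h1 ▸ exp_pos))
  have h₃ : (E⁄F).Nonsingular ((E⁄F).addX x₁ x₂ L) ((E⁄F).negAddY x₁ x₂ y₁ L) :=
    nonsingular_negAdd h₁ h₂ hxy
  have hneg : -(Point.some x₁ y₁ h₁ + .some x₂ y₂ h₂) =
      .some ((E⁄F).addX x₁ x₂ L) ((E⁄F).negAddY x₁ x₂ y₁ L) h₃ := by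
    rw [Point.add_some hxy, Point.neg_some, Point.some.injEq]
    exact ⟨rfl, by rw [addY, negY_negY]⟩
  rw [hneg]
  set x₃ := (E⁄F).addX x₁ x₂ L with hx₃
  have hmul : l * D.negation l = -((D.x - algebraMap F M x₁) * (D.x - algebraMap F M x₂) *
      (D.x - algebraMap F M x₃)) := by
    have h := congrArg (aeval D.x) ((E⁄F).addPolynomial_slope h₁.1 h₂.1 hxy)
    rw [addPolynomial_eq] at h
    simp only [Cubic.toPoly, map_neg, map_mul, map_sub, map_add, map_pow, aeval_X, aeval_C] at h
    rw [← hL, ← hx₃] at h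
    rw [← h]
    obtain ⟨e1, e2, e3, e4, e6⟩ := algebraMap_coeff (E := E) (F := F) (M := M)
    have hD := (equation_iff ..).mp D.equation
    rw [e1, e2, e3, e4, e6] at hD
    simp only [hl, hP, linePolynomial, map_add, map_mul, map_sub, map_neg, map_one, aeval_X,
      aeval_C, negation_x, negation_y, AlgHom.commutes, map_ofNat]
    linear_combination -hD
  have hon (A : (E⁄F).Point) (hA : A = .some x₁ y₁ h₁ ∨ A = .some x₂ y₂ h₂ ∨ A = .some _ _ h₃) :
      0 < D.div l A := by
    rw [D.div_pos_iff _ hl0]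
    rcases hA with rfl | rfl | rfl
    · rw [hl, D.vAt_lt_one_iff]
      simp [hPe]
    · rw [hl, D.vAt_lt_one_iff]
      simp only [eval_neg, eval_one, one_mul, hPe]
      by_cases hx : x₁ = x₂
      · have hy : y₁ ≠ (E⁄F).negY x₂ y₂ := fun h => hxy ⟨hx, h⟩
        rw [hx, Y_eq_of_Y_ne h₁.1 h₂.1 hx hy]
        ring
      · rw [hL, slope_of_X_ne hx]
        have := sub_ne_zero.mpr hx
        field_simp
        ring
    · rw [hl, D.vAt_lt_one_iff]
      simp only [eval_neg, eval_one, one_mul, hPe, negAddY]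
      rw [← hx₃]
      ring
  refine ⟨l, hl0, ?_⟩
  have hx1 := D.x_sub_ne_zero x₁
  have hx2 := D.x_sub_ne_zero x₂
  have hx3 := D.x_sub_ne_zero x₃
  have hdiv (S : (E⁄F).Point) := congrFun (congrArg D.div hmul) S
  rw [D.div_mul hl0 ((_root_.map_ne_zero _).mpr hl0), D.div_neg, D.div_mul (mul_ne_zero hx1 hx2) hx3,
    D.div_mul hx1 hx2, D.div_x_sub h₁, D.div_x_sub h₂, D.div_x_sub h₃] at hdiv
  simp only [Pi.add_apply, Pi.sub_apply, Pi.smul_apply, div_negation] at hdiv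
  ext S
  have hS := hdiv S
  simp only [Pi.add_apply, Pi.sub_apply, Pi.smul_apply] at hS ⊢
  simp only [nsmul_eq_mul] at hS ⊢
  push_cast at hS ⊢
  rw [← δ_neg, ← δ_neg, ← δ_neg] at hS
  by_cases hSS : -S = S
  · rw [hSS] at hS
    linarith
  · rcases S with _ | ⟨a, b, hab⟩
    · exact absurd rfl hSS
    have hlow (T : (E⁄F).Point) (hT : D.div l T = 0) : δ (.some x₁ y₁ h₁) T = 0 ∧
        δ (.some x₂ y₂ h₂) T = 0 ∧ δ (.some _ _ h₃) T = 0 := by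
      refine ⟨if_neg ?_, if_neg ?_, if_neg ?_⟩ <;> intro h <;> refine (hon T ?_).ne' hT <;>
        simp [h]
    rw [δ_zero_some] at hS ⊢
    have hge (a b : F) (hab : (E⁄F).Nonsingular a b) : 0 ≤ D.div l (.some a b hab) := by
      rw [D.div_nonneg_iff _ hl0]
      exact D.vAt_aeval_add_mul_y_le hab _ _
    -- `S` and `-S` share their `x`-coordinate, so two zeros of `y - P(x)` would force equal
    -- `y`-coordinates.
    have hzero : D.div l (.some a b hab) = 0 ∨ D.div l (-.some a b hab) = 0 := by
      by_contra hcon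
      push Not at hcon
      have h1 := lt_of_le_of_ne (hge a b hab) hcon.1.symm
      have h2 := lt_of_le_of_ne (hge _ _ _) hcon.2.symm
      rw [D.div_pos_iff _ hl0, hl, D.vAt_lt_one_iff] at h1 h2
      apply hSS
      rw [Point.neg_some, Point.some.injEq]
      refine ⟨rfl, ?_⟩
      simp only [eval_one, one_mul] at h1 h2
      linear_combination h2 - h1
    rcases hzero with h0 | h0
    · obtain ⟨h1, h2, h3⟩ := hlow _ h0
      rw [h0, h1, h2, h3]
      norm_num
    · obtain ⟨h1, h2, h3⟩ := hlow _ h0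
      rw [h0, h1, h2, h3] at hS
      linarith

/-- In the generic case, divide the line through `A` and `B` by the vertical line through `A + B`.
-/
lemma exists_div_add (A B : (E⁄F).Point) :
    ∃ f : M, f ≠ 0 ∧ D.div f = δ A + δ B - δ (A + B) - δ 0 := by
  by_cases hA : A = 0
  · refine ⟨1, one_ne_zero, ?_⟩
    rw [div_one, hA, zero_add]; abel
  by_cases hB : B = 0
  · refine ⟨1, one_ne_zero, ?_⟩
    rw [div_one, hB, add_zero]; abel
  rcases A with _ | ⟨x₁, y₁, h₁⟩
  · exact absurd rfl hA
  rcases B with _ | ⟨x₂, y₂, h₂⟩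
  · exact absurd rfl hB
  by_cases hxy : x₁ = x₂ ∧ y₁ = (E⁄F).negY x₂ y₂
  · refine ⟨_, D.x_sub_ne_zero x₂, ?_⟩
    obtain ⟨rfl, rfl⟩ := hxy
    rw [D.div_x_sub h₂, Point.add_of_Y_eq rfl rfl, Point.neg_some]
    abel
  · obtain ⟨l, hl, e⟩ := D.exists_line h₁ h₂ hxy
    have h := D.x_sub_ne_zero ((E⁄F).addX x₁ x₂ ((E⁄F).slope x₁ x₂ y₁ y₂))
    refine ⟨l / _, div_ne_zero hl h, ?_⟩
    rw [D.div_div hl h, e, Point.add_some hxy, D.div_x_sub (nonsingular_add h₁ h₂ hxy)]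
    abel

lemma exists_div_sum (S : ℕ → (E⁄F).Point) (n : ℕ) : ∃ f : M, f ≠ 0 ∧
    D.div f = ∑ i ∈ Finset.range n, (δ (S i) - δ 0) - (δ (∑ i ∈ Finset.range n, S i) - δ 0) := by
  induction n with
  | zero => exact ⟨1, one_ne_zero, by simp [div_one]⟩
  | succ n ih =>
    obtain ⟨f, hf, e⟩ := ih
    obtain ⟨g, hg, e'⟩ := D.exists_div_add (∑ i ∈ Finset.range n, S i) (S n)
    refine ⟨f * g, mul_ne_zero hf hg, ?_⟩
    rw [D.div_mul hf hg, e, e', Finset.sum_range_succ, Finset.sum_range_succ]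
    abel

end Line

/-! ### The pairing with a torsion point. -/

section Pairing

variable {K F M : Type*} [Field K] {E : Affine K} [E.IsElliptic] [Field F] [Field M]
  [Algebra K F] [Algebra F M] [Algebra K M] [IsScalarTower K F M] [IsAlgClosed F]
  [DecidableEq F] [DecidableEq M] (D : FunctionFieldModel E F M)

lemma prod_range_nsmul_shift {G A : Type*} [AddCommGroup G] [CommMonoid A] (g : G → A) {P : G}
    {ℓ : ℕ} (hP : ℓ • P = 0) (S : G) :
    ∏ i ∈ Finset.range ℓ, g (S + P + i • P) = ∏ i ∈ Finset.range ℓ, g (S + i • P) := by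
  cases ℓ with
  | zero => rfl
  | succ n =>
    rw [Finset.prod_range_succ, Finset.prod_range_succ', add_assoc, ← succ_nsmul', hP, zero_nsmul]
    congr 1
    refine Finset.prod_congr rfl fun i _ => ?_
    rw [add_assoc, ← succ_nsmul']

lemma sum_range_nsmul_shift {G A : Type*} [AddCommGroup G] [AddCommMonoid A] (g : G → A) {P : G}
    {ℓ : ℕ} (hP : ℓ • P = 0) (S : G) :
    ∑ i ∈ Finset.range ℓ, g (S + P + i • P) = ∑ i ∈ Finset.range ℓ, g (S + i • P) :=
  prod_range_nsmul_shift (A := Multiplicative A) g hP S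

/-- The sum of the translates of `T` by the first `ℓ` multiples of `P`, as a divisor. -/
noncomputable def orbit (P : (E⁄F).Point) (ℓ : ℕ) (T : (E⁄F).Point) (S : (E⁄F).Point) : ℤ :=
  ∑ i ∈ Finset.range ℓ, δ T (S + i • P)

lemma orbit_eq_sum (P : (E⁄F).Point) (ℓ : ℕ) (T : (E⁄F).Point) :
    orbit P ℓ T = ∑ i ∈ Finset.range ℓ, δ (T - i • P) := by
  ext S
  rw [orbit, Finset.sum_apply]
  refine Finset.sum_congr rfl fun i _ => ?_
  simp only [δ, eq_sub_iff_add_eq]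

lemma finsum_orbit (P : (E⁄F).Point) (ℓ : ℕ) (T : (E⁄F).Point) : ∑ᶠ S, orbit P ℓ T S = ℓ := by
  simp only [orbit_eq_sum, Finset.sum_apply]
  rw [finsum_sum_comm _ _ fun i _ => finite_support_δ _]
  simp [finsum_δ]

lemma finite_support_orbit (P : (E⁄F).Point) (ℓ : ℕ) (T : (E⁄F).Point) :
    (Function.support (orbit P ℓ T)).Finite := by
  rw [orbit_eq_sum]
  refine ((Finset.range ℓ).finite_toSet.biUnion fun i _ =>
    finite_support_δ (T - i • P)).subset fun S hS => ?_
  rw [Function.mem_support, Finset.sum_apply] at hS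
  obtain ⟨i, hi, h⟩ := Finset.exists_ne_zero_of_sum_ne_zero hS
  exact Set.mem_biUnion (Finset.mem_coe.mpr hi) h

variable {P : (E⁄F).Point} {ℓ : ℕ}

/-- The two orbits have the same length, and the same sum in the group because `ℓ • T = 0`. -/
lemma exists_div_orbit {T : (E⁄F).Point} (hT : ℓ • T = 0) :
    ∃ t : M, t ≠ 0 ∧ D.div t = orbit P ℓ T - orbit P ℓ 0 := by
  obtain ⟨f, hf, ef⟩ := D.exists_div_sum (fun i => T - i • P) ℓ
  obtain ⟨g, hg, eg⟩ := D.exists_div_sum (fun i => 0 - i • P) ℓ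
  refine ⟨f / g, div_ne_zero hf hg, ?_⟩
  rw [D.div_div hf hg, ef, eg, Finset.sum_sub_distrib, Finset.sum_sub_distrib, orbit_eq_sum,
    orbit_eq_sum, Finset.sum_sub_distrib, Finset.sum_sub_distrib (G := (E⁄F).Point)]
  simp only [Finset.sum_const, Finset.card_range, hT, nsmul_zero]
  abel

lemma orbit_add (hP : ℓ • P = 0) (T S : (E⁄F).Point) : orbit P ℓ T (S + P) = orbit P ℓ T S :=
  sum_range_nsmul_shift (δ T) hP S

/-- The values of the pairing with a torsion point `P`: the constant `c` by which translation by
`P` scales a function with divisor `∑ᵢ (T - iP) - ∑ᵢ (-iP)`. -/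
def IsPairing (P : (E⁄F).Point) (ℓ : ℕ) (T : (E⁄F).Point) (c : F) : Prop :=
  ∃ t : M, t ≠ 0 ∧ D.div t = orbit P ℓ T - orbit P ℓ 0 ∧ D.translation P t = algebraMap F M c * t

variable {D} {T T' : (E⁄F).Point} {c c' : F}

lemma IsPairing.unique (h : D.IsPairing P ℓ T c) (h' : D.IsPairing P ℓ T c') : c = c' := by
  obtain ⟨t, ht, hd, e⟩ := h
  obtain ⟨t', ht', hd', e'⟩ := h'
  obtain ⟨a, ha, rfl⟩ := D.exists_algebraMap_mul_eq ht ht' (hd.trans hd'.symm)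
  rw [map_mul, AlgHom.commutes, e', mul_left_comm] at e
  exact ((algebraMap F M).injective (mul_right_cancel₀ ht e)).symm

lemma IsPairing.ne_zero (h : D.IsPairing P ℓ T c) : c ≠ 0 := by
  rintro rfl
  obtain ⟨t, ht, hd, e⟩ := h
  rw [map_zero, zero_mul, _root_.map_eq_zero] at e
  exact ht e

/-- The divisor of `t` is invariant under translation by `P`, so the translate of `t` is a constant
multiple of `t`. -/
lemma exists_isPairing (hP : ℓ • P = 0) (hT : ℓ • T = 0) : ∃ c, D.IsPairing P ℓ T c := by
  obtain ⟨t, ht, hd⟩ := D.exists_div_orbit (P := P) hT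
  have ht' : D.translation P t ≠ 0 := (_root_.map_ne_zero _).mpr ht
  obtain ⟨a, ha, e⟩ := D.exists_algebraMap_mul_eq ht' ht (by
    ext S
    rw [div_translation, hd, Pi.sub_apply, Pi.sub_apply, orbit_add hP, orbit_add hP])
  exact ⟨a, t, ht, hd, e⟩

lemma isPairing_zero : D.IsPairing P ℓ 0 1 :=
  ⟨1, one_ne_zero, by rw [div_one, sub_self], by rw [map_one, map_one, one_mul]⟩

lemma IsPairing.add (hP : ℓ • P = 0) (h : D.IsPairing P ℓ T c) (h' : D.IsPairing P ℓ T' c') :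
    D.IsPairing P ℓ (T + T') (c * c') := by
  obtain ⟨t, ht, hd, e⟩ := h
  obtain ⟨t', ht', hd', e'⟩ := h'
  obtain ⟨g, hg, eg⟩ := D.exists_div_add T T'
  -- The norm of `g` along `⟨P⟩` is invariant under translation by `P`; dividing `t * t'` by it
  -- corrects the divisor without changing the scaling factor.
  set N : M := ∏ i ∈ Finset.range ℓ, D.translation (0 + i • P) g with hN
  have hN0 : N ≠ 0 := Finset.prod_ne_zero_iff.mpr fun i _ => (_root_.map_ne_zero _).mpr hg
  have hNP : D.translation P N = N := by
    rw [hN, map_prod, ← prod_range_nsmul_shift (fun S => D.translation S g) hP 0]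
    refine Finset.prod_congr rfl fun i _ => ?_
    rw [translation_translation]
    congr 2
  have hdN : D.div N = orbit P ℓ T + orbit P ℓ T' - orbit P ℓ (T + T') - orbit P ℓ 0 := by
    have (s : Finset ℕ) : D.div (∏ i ∈ s, D.translation (0 + i • P) g) =
        ∑ i ∈ s, D.div (D.translation (0 + i • P) g) := by
      induction s using Finset.induction_on with
      | empty => simp [div_one]
      | insert a s ha ih =>
        rw [Finset.prod_insert ha, Finset.sum_insert ha, D.div_mul, ih]
        · exact (_root_.map_ne_zero _).mpr hg
        · exact Finset.prod_ne_zero_iff.mpr fun i _ => (_root_.map_ne_zero _).mpr hg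
    ext S
    rw [hN, this, Finset.sum_apply]
    simp only [div_translation, eg, Pi.sub_apply, Pi.add_apply, orbit, zero_add,
      Finset.sum_sub_distrib, Finset.sum_add_distrib]
  refine ⟨t * t' / N, div_ne_zero (mul_ne_zero ht ht') hN0, ?_, ?_⟩
  · rw [D.div_div (mul_ne_zero ht ht') hN0, D.div_mul ht ht', hd, hd', hdN]
    abel
  · rw [map_div₀, map_mul, e, e', hNP, map_mul]
    ring

lemma IsPairing.map (σ : F ≃ₐ[K] F) (hσ : Point.map (W' := E) (σ : F →ₐ[K] F) P = P)
    (h : D.IsPairing P ℓ T c) :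
    D.IsPairing P ℓ (Point.map (W' := E) (σ : F →ₐ[K] F) T) (σ c) := by
  have hsurj (S : (E⁄F).Point) : ∃ S', Point.map (W' := E) (σ : F →ₐ[K] F) S' = S := by
    refine ⟨Point.map (W' := E) (σ.symm : F →ₐ[K] F) S, ?_⟩
    rw [Point.map_map, show (σ : F →ₐ[K] F).comp (σ.symm : F →ₐ[K] F) = AlgHom.id K F by ext; simp]
    exact Point.map_id S
  obtain ⟨t, ht, hd, e⟩ := h
  -- The semilinear extension of `σ` to `M` fixing `x` and `y`. It preserves `v` and conjugates
  -- translation by `S` into translation by `σS`, so it transports divisors along `σ`.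
  obtain ⟨f, hf, hx, hy⟩ := D.exists_lift ((IsScalarTower.toAlgHom K F M).comp σ) D.x D.y
    D.equation (fun p hp => by
      have := D.aeval_ne_zero (p := p.map (σ : F →+* F)) ((Polynomial.map_ne_zero_iff σ.injective).mpr hp)
      rwa [aeval_def, eval₂_map] at this)
  have hf' (c : F) : f (algebraMap F M c) = algebraMap F M (σ c) := hf c
  have hG : Point.map (W' := E) f D.generic = D.generic := by
    rw [generic, Point.map_some, Point.some.injEq]
    exact ⟨hx, hy⟩
  have hS (S : (E⁄F).Point) : Point.map (W' := E) f (constPoint M S) =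
      constPoint M (Point.map (W' := E) (σ : F →ₐ[K] F) S) := by
    rcases S with _ | ⟨a, b, hab⟩
    · rfl
    · exact (Point.some.injEq ..).mpr ⟨hf' a, hf' b⟩
  have hv (m : M) : D.v (f m) = D.v m := by
    have : D.IsInfty (D.v.comap (f : M →+* M)) := by
      refine ⟨fun c hc => ?_, ?_, ?_⟩
      · rw [Valuation.comap_apply, RingHom.coe_coe, hf',
          D.v_const _ ((_root_.map_ne_zero _).mpr hc)]
      · rw [Valuation.comap_apply, RingHom.coe_coe, hx, D.v_x]
      · rw [Valuation.comap_apply, RingHom.coe_coe, hy, D.v_y]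
    exact congr($(this.eq D.isInfty_v) m)
  have hτ (S : (E⁄F).Point) (m : M) :
      D.translation (Point.map (W' := E) (σ : F →ₐ[K] F) S) (f m) = f (D.translation S m) := by
    have : ((D.translation (Point.map (W' := E) (σ : F →ₐ[K] F) S)).restrictScalars K).comp f =
        f.comp ((D.translation S).restrictScalars K) := by
      apply D.algHom_eq
      · intro c
        simp only [AlgHom.comp_apply, AlgHom.restrictScalars_apply, AlgHom.commutes, hf']
      · rw [← Point.map_map, ← Point.map_map, hG]
        refine (D.map_translation_generic _).trans ?_
        rw [← hS]
        nth_rw 1 [← hG]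
        rw [← map_add, ← map_translation_generic]
        rfl
    exact congr($this m)
  have hdiv (m : M) (S : (E⁄F).Point) : D.div (f m) (Point.map (W' := E) (σ : F →ₐ[K] F) S) = D.div m S := by
    rw [div, vAt_apply, hτ, hv]; rfl
  refine ⟨f t, (_root_.map_ne_zero _).mpr ht, ?_, ?_⟩
  · ext S
    obtain ⟨S, rfl⟩ := hsurj S
    have horb (A : (E⁄F).Point) : orbit P ℓ (Point.map (W' := E) (σ : F →ₐ[K] F) A)
        (Point.map (W' := E) (σ : F →ₐ[K] F) S) = orbit P ℓ A S := by
      refine Finset.sum_congr rfl fun i _ => ?_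
      nth_rw 1 [← hσ]
      rw [← map_nsmul, ← map_add]
      simp only [δ, (Point.map_injective (W' := E) (σ : F →ₐ[K] F)).eq_iff]
    have horb0 := horb 0
    rw [map_zero] at horb0
    rw [hdiv, hd, Pi.sub_apply, Pi.sub_apply, horb, horb0]
  · rw [← hf', ← map_mul, ← e, ← hτ, hσ]

end Pairing

/-! ### Nondegeneracy of the pairing. -/

section Kernel

variable {K F M : Type*} [Field K] {E : Affine K} [E.IsElliptic] [Field F] [Field M]
  [Algebra K F] [Algebra F M] [Algebra K M] [IsScalarTower K F M] [IsAlgClosed F]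
  [DecidableEq F] [DecidableEq M] {D : FunctionFieldModel E F M}
  {P : (E⁄F).Point} {ℓ : ℕ} {T S : (E⁄F).Point}

lemma orbit_of_not_mem (h : S - T ∉ AddSubgroup.zmultiples P) : orbit P ℓ T S = 0 := by
  refine Finset.sum_eq_zero fun i _ => if_neg fun hi => h ?_
  rw [← hi, sub_add_cancel_left]
  exact neg_mem (AddSubgroup.nsmul_mem_zmultiples P i)

/-- Because the order of `P` is exactly `ℓ`, the orbit divisor is the indicator of the coset `T +
⟨P⟩`, without multiplicities. -/
lemma orbit_of_mem (hℓ : ℓ ≠ 0) (hP : addOrderOf P = ℓ) (h : S - T ∈ AddSubgroup.zmultiples P) :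
    orbit P ℓ T S = 1 := by
  subst hP
  have hfin : IsOfFinAddOrder P := addOrderOf_ne_zero_iff.mp hℓ
  have h' := neg_mem h
  rw [hfin.mem_zmultiples_iff_mem_range_addOrderOf, Finset.mem_image] at h'
  obtain ⟨i, hi, e⟩ := h'
  rw [orbit, Finset.sum_eq_single_of_mem i hi]
  · exact if_pos (by rw [e]; abel)
  · intro j hj hij
    refine if_neg fun hjT => hij ?_
    refine nsmul_injOn_Iio_addOrderOf (Finset.mem_range.mp hj) (Finset.mem_range.mp hi) ?_
    dsimp only
    rw [e, ← hjT]
    abel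

lemma div_add_of_mem {f : M} (hf : ∀ S, D.div f (S + P) = D.div f S) {A B : (E⁄F).Point}
    (h : A - B ∈ AddSubgroup.zmultiples P) : D.div f A = D.div f B := by
  have key (n : ℕ) (S : (E⁄F).Point) : D.div f (S + n • P) = D.div f S := by
    induction n with
    | zero => rw [zero_nsmul, add_zero]
    | succ n ih => rw [succ_nsmul, ← add_assoc, hf, ih]
  obtain ⟨n, hn⟩ := AddSubgroup.mem_zmultiples_iff.mp h
  obtain ⟨m, rfl | rfl⟩ := n.eq_nat_or_neg
  · rw [← key m B, ← natCast_zsmul, hn, add_sub_cancel]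
  · rw [← key m A]
    congr 1
    rw [neg_zsmul, natCast_zsmul] at hn
    rw [← neg_eq_iff_eq_neg.mpr hn.symm]
    abel

/-- The function is a Lagrange resolvent `∑ ζ ^ i τ_{iP}(m)`, nonzero for some `m` by Dedekind
independence of the distinct translations. -/
lemma exists_translation_eq_mul (hℓ : ℓ ≠ 0) (hP : addOrderOf P = ℓ) {ζ : F} (hζ : ζ ^ ℓ = 1) :
    ∃ y : M, y ≠ 0 ∧ algebraMap F M ζ * D.translation P y = y := by
  have hζ0 : ζ ≠ 0 := by
    rintro rfl
    rw [zero_pow hℓ] at hζ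
    exact zero_ne_one hζ
  let g : Fin ℓ → M →* M := fun i => (D.translation ((i : ℕ) • P) : M →* M)
  have hg : Function.Injective g := by
    intro i j hij
    have h1 : D.translation ((i : ℕ) • P) = D.translation ((j : ℕ) • P) := by
      ext m
      exact congr($hij m)
    have h2 := D.translation_injective h1
    exact Fin.ext (nsmul_injOn_Iio_addOrderOf (hP ▸ i.2) (hP ▸ j.2) h2)
  have hind := (linearIndependent_monoidHom M M).comp g hg
  have hex : ∃ m : M, ∑ i ∈ Finset.range ℓ, algebraMap F M ζ ^ i * D.translation (i • P) m ≠ 0 := by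
    by_contra! hcon
    rw [Fintype.linearIndependent_iff] at hind
    have := hind (fun i => algebraMap F M ζ ^ (i : ℕ)) (by
      ext m
      rw [Finset.sum_apply, Pi.zero_apply, ← hcon m, Finset.sum_range]
      rfl) ⟨0, Nat.pos_of_ne_zero hℓ⟩
    exact one_ne_zero ((pow_zero _).symm.trans this)
  obtain ⟨m, hm⟩ := hex
  refine ⟨_, hm, ?_⟩
  cases ℓ with
  | zero => exact absurd rfl hℓ
  | succ n =>
    have h0 : D.translation ((n + 1) • P) m = m := by
      rw [← hP, addOrderOf_nsmul_eq_zero, translation_zero]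
    have hζ' : algebraMap F M ζ ^ (n + 1) = 1 := by rw [← map_pow, hζ, map_one]
    rw [map_sum, Finset.mul_sum, Finset.sum_range_succ, Finset.sum_range_succ']
    congr 1
    · refine Finset.sum_congr rfl fun i _ => ?_
      rw [map_mul, map_pow, AlgHom.commutes, translation_translation, ← mul_assoc, ← pow_succ',
        ← succ_nsmul']
    · rw [map_mul, map_pow, AlgHom.commutes, translation_translation, ← mul_assoc, ← pow_succ',
        ← succ_nsmul', h0, hζ', pow_zero, zero_nsmul, translation_zero]

/-- A function with divisor the orbit of `S` minus the orbit of the origin. -/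
lemma exists_div_orbit_of_not_mem (hℓ : ℓ ≠ 0) (hP : addOrderOf P = ℓ) {t : M} (ht : t ≠ 0)
    (hd : D.div t = orbit P ℓ T - orbit P ℓ 0) (hT : T ∉ AddSubgroup.zmultiples P)
    (htP : D.translation P t = t) (hS : S ∉ AddSubgroup.zmultiples P) :
    ∃ z : M, z ≠ 0 ∧ D.div z = orbit P ℓ S - orbit P ℓ 0 ∧ D.translation P z = z := by
  have hnn (A B : (E⁄F).Point) : 0 ≤ orbit P ℓ A B := by
    by_cases h : B - A ∈ AddSubgroup.zmultiples P
    · rw [orbit_of_mem hℓ hP h]; norm_num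
    · rw [orbit_of_not_mem h]
  have hlow (A : (E⁄F).Point) (hA : A ∉ AddSubgroup.zmultiples P) : 0 ≤ D.div t A := by
    rw [hd, Pi.sub_apply, orbit_of_not_mem (T := 0) (by rwa [sub_zero]), sub_zero]
    exact hnn _ _
  -- Here `c` is the value of `t` at `S`; the function sought is `t - c`.
  obtain ⟨c, hc⟩ := D.exists_residue (f := D.translation S t) ((D.div_nonneg_iff S ht).mp (hlow S hS))
  rw [← AlgHom.commutes (D.translation S), ← map_sub, ← vAt_apply] at hc
  have hz : t - algebraMap F M c ≠ 0 := by
    intro h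
    rw [sub_eq_zero] at h
    have hc0 : c ≠ 0 := by
      rintro rfl
      rw [map_zero] at h
      exact ht h
    have := congrFun hd T
    rw [h, D.div_algebraMap hc0, Pi.sub_apply, orbit_of_mem hℓ hP (by rw [sub_self]; exact zero_mem _),
      orbit_of_not_mem (by rwa [sub_zero])] at this
    exact absurd this (by norm_num)
  have hzP : D.translation P (t - algebraMap F M c) = t - algebraMap F M c := by
    rw [map_sub, htP, AlgHom.commutes]
  refine ⟨_, hz, ?_, hzP⟩
  set z := t - algebraMap F M c with hzdef
  have hzdiv (A : (E⁄F).Point) : D.div z (A + P) = D.div z A := by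
    rw [← div_translation, hzP]
  -- `t - c` has at most simple poles, all on `⟨P⟩`, and vanishes on all of `S + ⟨P⟩` by invariance.
  -- Both divisors have degree zero, so this inequality is an equality.
  have hge (A : (E⁄F).Point) : orbit P ℓ S A - orbit P ℓ 0 A ≤ D.div z A := by
    by_cases hA : A ∈ AddSubgroup.zmultiples P
    · rw [orbit_of_mem (T := 0) hℓ hP (by rwa [sub_zero]), orbit_of_not_mem (T := S), zero_sub]
      · have h1 : -1 ≤ D.div t A := by
          rw [hd, Pi.sub_apply, orbit_of_mem (T := 0) hℓ hP (by rwa [sub_zero])]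
          linarith [hnn T A]
        have h2 : D.vAt A z ≤ max (D.vAt A t) (D.vAt A (algebraMap F M c)) := Valuation.map_sub _ _ _
        have h3 : D.vAt A z ≤ exp 1 := by
          refine h2.trans (max_le ?_ ((D.vAt_const_le A c).trans ?_))
          · rw [D.vAt_eq_exp A ht, exp_le_exp]; linarith
          · rw [← exp_zero, exp_le_exp]; norm_num
        rw [D.vAt_eq_exp A hz, exp_le_exp] at h3
        linarith
      · intro h
        apply hS
        have := sub_mem hA h
        rwa [sub_sub_cancel] at this
    · rw [orbit_of_not_mem (T := 0) (by rwa [sub_zero]), sub_zero]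
      by_cases hAS : A - S ∈ AddSubgroup.zmultiples P
      · rw [orbit_of_mem hℓ hP hAS, div_add_of_mem hzdiv hAS]
        exact (D.div_pos_iff S hz).mpr hc
      · rw [orbit_of_not_mem hAS, D.div_nonneg_iff A hz]
        exact (Valuation.map_sub _ _ _).trans
          (max_le ((D.div_nonneg_iff A ht).mp (hlow A hA)) (D.vAt_const_le A c))
  have hfin : (Function.support fun A => D.div z A + orbit P ℓ 0 A - orbit P ℓ S A).Finite :=
    (((D.finite_support_div hz).union (finite_support_orbit P ℓ 0)).union
      (finite_support_orbit P ℓ S)).subset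
      ((Function.support_sub _ _).trans (Set.union_subset_union_left _ (Function.support_add _ _)))
  have hsum : ∑ᶠ A, (D.div z A + orbit P ℓ 0 A - orbit P ℓ S A) = 0 := by
    rw [finsum_sub_distrib _ (finite_support_orbit P ℓ S),
      finsum_add_distrib (D.finite_support_div hz) (finite_support_orbit P ℓ 0),
      finsum_orbit, finsum_orbit, D.finsum_div hz]
    · ring
    · exact ((D.finite_support_div hz).union (finite_support_orbit P ℓ 0)).subset
        (Function.support_add _ _)
  ext A
  rw [finsum_eq_sum _ hfin, Finset.sum_eq_zero_iff_of_nonneg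
    (fun A _ => by linarith [hge A])] at hsum
  by_cases hA : A ∈ hfin.toFinset
  · have := hsum A hA
    rw [Pi.sub_apply]
    linarith
  · rw [Set.Finite.mem_toFinset, Function.notMem_support] at hA
    rw [Pi.sub_apply]
    linarith

/-- Nondegeneracy of the pairing. -/
theorem IsPairing.mem_zmultiples (hℓ : ℓ ≠ 0) (hP : addOrderOf P = ℓ) {ζ : F} (hζ : ζ ^ ℓ = 1)
    (hζ1 : ζ ≠ 1) (h : D.IsPairing P ℓ T 1) : T ∈ AddSubgroup.zmultiples P := by
  by_contra hT
  obtain ⟨t, ht, hd, htP⟩ := h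
  rw [map_one, one_mul] at htP
  have hinv {y : M} (hy : algebraMap F M ζ * D.translation P y = y) (A : (E⁄F).Point) :
      D.div y (A + P) = D.div y A := by
    have hζ0 : ζ ≠ 0 := by
      rintro rfl
      rw [zero_pow hℓ] at hζ
      exact zero_ne_one hζ
    by_cases hy0 : y = 0
    · simp [hy0, div]
    nth_rw 2 [← hy]
    rw [D.div_mul ((_root_.map_ne_zero _).mpr hζ0) ((_root_.map_ne_zero _).mpr hy0),
      D.div_algebraMap hζ0, zero_add, div_translation]
  -- Strong induction on the number of zeros and poles of the eigenfunction `y` outside `⟨P⟩`.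
  have key (n : ℕ) : ∀ y : M, y ≠ 0 → algebraMap F M ζ * D.translation P y = y →
      (Function.support (D.div y) \ AddSubgroup.zmultiples P).ncard = n → False := by
    induction n using Nat.strong_induction_on with
    | _ n ih =>
      intro y hy0 hy hn
      have hfin : (Function.support (D.div y) \ AddSubgroup.zmultiples P).Finite :=
        (D.finite_support_div hy0).subset Set.sdiff_subset
      rcases (Function.support (D.div y) \ AddSubgroup.zmultiples P).eq_empty_or_nonempty with
        he | ⟨S, hS1, hS2⟩
      · have hdiv (A : (E⁄F).Point) : D.div y A = 0 ∨ D.div y A = D.div y 0 := by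
          by_cases hA : A ∈ AddSubgroup.zmultiples P
          · exact .inr (div_add_of_mem (hinv hy) (by rwa [sub_zero]))
          · left
            by_contra hcon
            exact he.subset ⟨hcon, hA⟩
        -- The divisor is now a multiple of the coset `⟨P⟩`, hence has one sign, so `y` or its
        -- inverse has no poles. A nonzero constant cannot satisfy the eigenvalue equation with `ζ ≠
        -- 1`.
        have hconst : ∃ c : F, y = algebraMap F M c := by
          rcases le_total 0 (D.div y 0) with h0 | h0
          · obtain ⟨c, -, hc⟩ := D.exists_eq_algebraMap_of_div_nonneg hy0 fun A => by
              rcases hdiv A with h | h <;> omega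
            exact ⟨c, hc⟩
          · obtain ⟨c, -, hc⟩ := D.exists_eq_algebraMap_of_div_nonneg (inv_ne_zero hy0) fun A => by
              rw [div_inv, Pi.neg_apply]
              rcases hdiv A with h | h <;> omega
            exact ⟨c⁻¹, by rw [map_inv₀, ← hc, inv_inv]⟩
        obtain ⟨c, rfl⟩ := hconst
        rw [AlgHom.commutes] at hy
        have := mul_right_cancel₀ hy0 (hy.trans (one_mul _).symm)
        rw [← map_one (algebraMap F M)] at this
        exact hζ1 ((algebraMap F M).injective this)
      · obtain ⟨z, hz, hdz, hzP⟩ := exists_div_orbit_of_not_mem hℓ hP ht hd hT htP hS2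
        have hzk := zpow_ne_zero (D.div y S) hz
        -- Dividing by a power of the invariant `z` keeps the eigenvalue and clears the whole coset
        -- `S + ⟨P⟩`; any new zeros or poles lie on `⟨P⟩`.
        have hy' : algebraMap F M ζ * D.translation P (y / z ^ D.div y S) = y / z ^ D.div y S := by
          rw [map_div₀, map_zpow₀, hzP, mul_div_assoc', hy]
        have hdy' (A : (E⁄F).Point) (hA : A ∉ AddSubgroup.zmultiples P) :
            D.div (y / z ^ D.div y S) A = D.div y A - D.div y S * orbit P ℓ S A := by
          rw [D.div_div hy0 hzk, div_zpow, hdz, Pi.sub_apply, Pi.smul_apply, Pi.sub_apply,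
            orbit_of_not_mem (T := 0) (by rwa [sub_zero]), sub_zero, smul_eq_mul]
        refine ih _ ?_ _ (div_ne_zero hy0 hzk) hy' rfl
        rw [← hn]
        refine Set.ncard_lt_ncard ⟨?_, fun hsub => ?_⟩ hfin
        · rintro A ⟨hA1, hA2⟩
          refine ⟨fun h0 => hA1 ?_, hA2⟩
          rw [hdy' A hA2, h0]
          by_cases hAS : A - S ∈ AddSubgroup.zmultiples P
          · exact absurd (h0.symm.trans (div_add_of_mem (hinv hy) hAS)).symm hS1
          · rw [orbit_of_not_mem hAS]; ring
        · refine (hsub ⟨hS1, hS2⟩).1 ?_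
          rw [hdy' S hS2, orbit_of_mem hℓ hP (by rw [sub_self]; exact zero_mem _)]
          ring
  obtain ⟨y, hy0, hy⟩ := exists_translation_eq_mul (D := D) hℓ hP hζ
  exact key _ y hy0 hy rfl

end Kernel

end FunctionFieldModel
end WeierstrassCurve.Affine

/-! ### The actual function field as a model. -/

namespace WeierstrassCurve.Affine

open Polynomial WithZero

lemma FunctionField.exists_lift_algHom {K : Type*} [Field K] (E : Affine K) {F N : Type*} [Field F]
    [Algebra K F] [Field N] [Algebra K N] (φ : F →ₐ[K] N) (a b : N) (h : (E⁄N).Equation a b)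
    (ha : ∀ p : F[X], p ≠ 0 → p.eval₂ (φ : F →+* N) a ≠ 0) :
    ∃ f : (E⁄F).FunctionField →ₐ[K] N, (∀ c, f (algebraMap F _ c) = φ c) ∧
      f (FunctionField.x (E⁄F)) = a ∧ f (FunctionField.y (E⁄F)) = b := by
  have h' : (E⁄F).map (φ : F →+* N) = (E⁄N) :=
    (WeierstrassCurve.map_map E (algebraMap K F) (φ : F →+* N)).trans
      (congrArg (WeierstrassCurve.map E) φ.comp_algebraMap)
  rw [← h'] at h
  obtain ⟨f, hf, hx, hy⟩ := FunctionField.exists_lift (E⁄F) (φ : F →+* N) a b h ha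
  refine ⟨AlgHom.mk f fun r => ?_, hf, hx, hy⟩
  change f _ = _
  rw [IsScalarTower.algebraMap_apply K F, hf, RingHom.coe_coe, AlgHom.commutes]

/-- The function field of an elliptic curve. -/
noncomputable def FunctionField.model {K : Type*} [Field K] (E : Affine K) (F : Type*) [Field F]
    [Algebra K F] : FunctionFieldModel E F (E⁄F).FunctionField where
  x := FunctionField.x (E⁄F)
  y := FunctionField.y (E⁄F)
  equation := FunctionField.equation_x_y E
  v := FunctionField.inftyValuation (E⁄F)
  v_const _ hc := FunctionField.inftyValuation_const _ hc
  v_x := FunctionField.inftyValuation_x _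
  v_y := FunctionField.inftyValuation_y _
  exists_mul_eq := FunctionField.exists_mul_eq _
  exists_lift := FunctionField.exists_lift_algHom E

/-! ### Finiteness of the `ℓ`-torsion and algebraicity of `ℓ`-division points. -/

section Torsion

variable {K F : Type*} [Field K] [Field F] [Algebra K F] [IsAlgClosed F] [CharZero F]
  [DecidableEq F] (E : Affine K) [E.IsElliptic]

theorem exists_pairing {ℓ : ℕ} (hℓ : ℓ.Prime) {P : (E⁄F).Point} (hP : addOrderOf P = ℓ)
    (hσ : ∀ σ : F ≃ₐ[K] F, Point.map (W' := E) (σ : F →ₐ[K] F) P = P) :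
    ∃ e : (E⁄F).Point → F, e 0 = 1 ∧ (∀ T, ℓ • T = 0 → e T ≠ 0) ∧
      (∀ T T', ℓ • T = 0 → ℓ • T' = 0 → e (T + T') = e T * e T') ∧
      (∀ (σ : F ≃ₐ[K] F) T, ℓ • T = 0 → e (Point.map (W' := E) (σ : F →ₐ[K] F) T) = σ (e T)) ∧
      ∀ T, ℓ • T = 0 → e T = 1 → T ∈ AddSubgroup.zmultiples P := by
  classical
  have hP' : ℓ • P = 0 := hP ▸ addOrderOf_nsmul_eq_zero P
  let D := FunctionField.model E F
  have hex (T : (E⁄F).Point) : ∃ c, ℓ • T = 0 → D.IsPairing P ℓ T c := by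
    by_cases hT : ℓ • T = 0
    · obtain ⟨c, hc⟩ := FunctionFieldModel.exists_isPairing (D := D) hP' hT
      exact ⟨c, fun _ => hc⟩
    · exact ⟨0, fun h => absurd h hT⟩
  choose e he using hex
  refine ⟨e, ?_, fun T hT => (he T hT).ne_zero, fun T T' hT hT' => ?_, fun σ T hT => ?_,
    fun T hT h1 => ?_⟩
  · exact (he 0 (nsmul_zero _)).unique FunctionFieldModel.isPairing_zero
  · exact (he _ (by rw [nsmul_add, hT, hT', add_zero])).unique ((he T hT).add hP' (he T' hT'))
  · exact (he _ (by rw [← map_nsmul, hT, _root_.map_zero])).unique ((he T hT).map σ (hσ σ))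
  · have : NeZero (ℓ : F) := ⟨Nat.cast_ne_zero.mpr hℓ.ne_zero⟩
    obtain ⟨ζ, hζ⟩ := HasEnoughRootsOfUnity.exists_primitiveRoot F ℓ
    exact (h1 ▸ he T hT).mem_zmultiples hℓ.ne_zero hP hζ.pow_eq_one (hζ.ne_one hℓ.one_lt)

variable {E}

/-- The pairing takes values in the `ℓ`-th roots of unity, and each fibre lies in a coset of `⟨P⟩`.
-/
lemma finite_setOf_nsmul_eq_zero {ℓ : ℕ} (hℓ : ℓ.Prime) {P : (E⁄F).Point} (hP : addOrderOf P = ℓ)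
    (hσ : ∀ σ : F ≃ₐ[K] F, Point.map (W' := E) (σ : F →ₐ[K] F) P = P) :
    {T : (E⁄F).Point | ℓ • T = 0}.Finite := by
  obtain ⟨e, he0, -, hadd, -, hker⟩ := exists_pairing E hℓ hP hσ
  have hpow (n : ℕ) {T : (E⁄F).Point} (hT : ℓ • T = 0) : e (n • T) = e T ^ n := by
    induction n with
    | zero => rw [zero_nsmul, he0, pow_zero]
    | succ n ih =>
      rw [succ_nsmul, hadd _ _ (by rw [← mul_nsmul', mul_comm, mul_nsmul', hT, nsmul_zero]) hT, ih, pow_succ]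
  have hfinP : (AddSubgroup.zmultiples P : Set (E⁄F).Point).Finite :=
    finite_zmultiples.mpr (addOrderOf_ne_zero_iff.mp (hP ▸ hℓ.ne_zero))
  refine Set.Finite.of_finite_fibers e ?_ ?_
  · refine ((X ^ ℓ - C (1 : F)).rootSet_finite F).subset ?_
    rintro _ ⟨T, hT, rfl⟩
    rw [mem_rootSet_of_ne (X_pow_sub_C_ne_zero hℓ.pos 1)]
    simp [← hpow ℓ hT, hT.out, he0]
  · rintro _ ⟨T, hT, rfl⟩
    refine (hfinP.preimage (f := fun S => S - T) (sub_left_injective.injOn)).subset ?_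
    rintro S ⟨hS, hST : e S = e T⟩
    have hneg : ℓ • -T = 0 := by rw [smul_neg, hT.out, neg_zero]
    refine hker _ (by rw [nsmul_sub, hT.out, hS.out, sub_zero]) ?_
    dsimp only
    rw [sub_eq_add_neg, hadd _ _ hS hneg, hST, ← hadd _ _ hT hneg, add_neg_cancel, he0]

lemma infinite_point : Infinite (E⁄F).Point := by
  choose t ht using FunctionFieldModel.exists_nonsingular (F := F) E
  exact Infinite.of_injective (fun s => Point.some s (t s) (ht s)) fun a b h => (Point.some.inj h).1

/-- Translation by `S` would add `ℓ • S` to the left side and fix the right, making the infinite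
group `E(F)` equal to its finite `ℓ`-torsion. -/
lemma nsmul_generic_ne_constPoint {M : Type*} [Field M] [Algebra F M] [Algebra K M]
    [IsScalarTower K F M] [DecidableEq M] (D : FunctionFieldModel E F M) {ℓ : ℕ} (hℓ : ℓ.Prime)
    {P : (E⁄F).Point} (hP : addOrderOf P = ℓ)
    (hσ : ∀ σ : F ≃ₐ[K] F, Point.map (W' := E) (σ : F →ₐ[K] F) P = P) (R : (E⁄F).Point) :
    ℓ • D.generic ≠ FunctionFieldModel.constPoint M R := by
  intro h
  have := infinite_point (K := K) (E := E) (F := F)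
  refine Set.infinite_univ ((finite_setOf_nsmul_eq_zero hℓ hP hσ).subset fun S _ => ?_)
  have h1 := congrArg (Point.map (W' := E) (D.translation S)) h
  rw [map_nsmul, D.map_translation_generic, FunctionFieldModel.map_constPoint, nsmul_add, h,
    add_eq_left] at h1
  apply FunctionFieldModel.constPoint_injective (M := M)
  rw [FunctionFieldModel.constPoint_zero, ← h1]
  exact map_nsmul (Point.baseChange (W' := E) F M) ℓ S

/-- A point with a rational multiple of order `ℓ` is algebraic. -/
theorem isAlgebraic_of_nsmul_eq {L : Type*} [Field L] [Algebra K L] [DecidableEq L] [DecidableEq K]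
    {ℓ : ℕ} (hℓ : ℓ.Prime) {P : (E⁄F).Point} (hP : addOrderOf P = ℓ)
    (hσ : ∀ σ : F ≃ₐ[K] F, Point.map (W' := E) (σ : F →ₐ[K] F) P = P) {a b : L}
    (hab : (E⁄L).Nonsingular a b) {R : (E⁄K).Point}
    (hR : ℓ • Point.some a b hab = Point.baseChange K L R) : IsAlgebraic K a := by
  classical
  by_contra ha
  let N := (E⁄K).FunctionField
  let M := (E⁄F).FunctionField
  let D := FunctionField.model E F
  let D₀ := FunctionField.model E K
  -- If `a` is transcendental, `(a, b)` is the image of the generic point of `E` over `K`. The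
  -- relation is pulled back to `K(E)` along `f` and pushed to `F(E)` along `g`.
  obtain ⟨f, -, hfx, hfy⟩ := FunctionField.exists_lift_algHom E (Algebra.ofId K L) a b hab.1
    (fun p hp h => ha ⟨p, hp, h⟩)
  obtain ⟨g, -, hgx, hgy⟩ := FunctionField.exists_lift_algHom E (Algebra.ofId K M) D.x D.y D.equation
    (fun p hp h => by
      have := FunctionFieldModel.aeval_ne_zero (D := D) (p := p.map (algebraMap K F))
        ((Polynomial.map_ne_zero_iff (algebraMap K F).injective).mpr hp)
      rw [aeval_map_algebraMap] at this
      exact this h)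
  have hfG : Point.map (W' := E) f D₀.generic = .some a b hab :=
    (Point.some.injEq ..).mpr ⟨hfx, hfy⟩
  have hgG : Point.map (W' := E) g D₀.generic = D.generic :=
    (Point.some.injEq ..).mpr ⟨hgx, hgy⟩
  have h1 : ℓ • D₀.generic = Point.baseChange K N R := by
    apply Point.map_injective (W' := E) f
    rw [map_nsmul, hfG, hR, Point.map_baseChange]
  have h2 := congrArg (Point.map (W' := E) g) h1
  rw [map_nsmul, hgG, Point.map_baseChange] at h2
  refine nsmul_generic_ne_constPoint D hℓ hP hσ (Point.baseChange K F R) (h2.trans ?_)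
  rcases R with _ | ⟨_, _, _⟩
  · rfl
  · refine (Point.some.injEq ..).mpr ⟨IsScalarTower.algebraMap_apply K F M _, IsScalarTower.algebraMap_apply K F M _⟩

end Torsion

end WeierstrassCurve.Affine

/-! ### Radical extensions of prime degree. -/

section Kummer

open Polynomial

variable {K L : Type*} [Field K] [CharZero K] [Field L] [Algebra K L]

/-- If `α ^ ℓ ∈ K` then `X ^ ℓ - α ^ ℓ` is irreducible, or `L` contains a cyclic extension. -/
lemma irreducible_or_exists_isCyclicExtension {ℓ : ℕ} (hℓ : ℓ.Prime) {α : L} {a : K}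
    (ha : α ^ ℓ = algebraMap K L a) (hα : α ∉ Set.range (algebraMap K L)) :
    Irreducible (X ^ ℓ - C a) ∨ ∃ F : IntermediateField K L, F ≠ ⊥ ∧ IsCyclicExtension K F := by
  rw [X_pow_sub_C_irreducible_iff_of_prime hℓ]
  by_cases hb : ∀ b, b ^ ℓ ≠ a
  · exact .inl hb
  right
  push Not at hb
  obtain ⟨β, rfl⟩ := hb
  have : Fact ℓ.Prime := ⟨hℓ⟩
  have : NeZero ℓ := ⟨hℓ.ne_zero⟩
  have hα0 : α ≠ 0 := by
    rintro rfl
    exact hα ⟨0, map_zero _⟩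
  have hβ0 : algebraMap K L β ≠ 0 := by
    intro h
    rw [map_pow, h, zero_pow hℓ.ne_zero] at ha
    exact hα0 (eq_zero_of_pow_eq_zero ha)
  have hη : α / algebraMap K L β ∉ Set.range (algebraMap K L) := by
    rintro ⟨γ, hγ⟩
    exact hα ⟨γ * β, by rw [map_mul, hγ, div_mul_cancel₀ _ hβ0]⟩
  have hprim : IsPrimitiveRoot (α / algebraMap K L β) ℓ := by
    rw [IsPrimitiveRoot.iff_orderOf]
    refine orderOf_eq_prime (by rw [div_pow, ha, map_pow, div_self (pow_ne_zero _ hβ0)]) fun h => ?_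
    exact hη ⟨1, by rw [h, map_one]⟩
  have hcyc : IsCyclotomicExtension {ℓ} K K⟮α / algebraMap K L β⟯ :=
by
    have hint : IsIntegral K (α / algebraMap K L β) := hprim.isIntegral hℓ.pos |>.tower_top
    change IsCyclotomicExtension {ℓ} K K⟮α / algebraMap K L β⟯.toSubalgebra
    rw [IntermediateField.adjoin_simple_toSubalgebra_of_isAlgebraic hint.isAlgebraic]
    exact hprim.adjoin_isCyclotomicExtension K
  refine ⟨K⟮α / algebraMap K L β⟯, fun h => hη ?_, ?_, ?_, ?_⟩
  · rw [IntermediateField.adjoin_simple_eq_bot_iff, IntermediateField.mem_bot] at h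
    exact h
  · exact IsCyclotomicExtension.finiteDimensional {ℓ} K _
  · exact IsCyclotomicExtension.isGalois {ℓ} K _
  · have hz := IsCyclotomicExtension.zeta_spec ℓ K K⟮α / algebraMap K L β⟯
    -- The Galois group embeds in the units of `ZMod ℓ`, cyclic because `ℓ` is prime.
    exact isCyclic_of_injective (hz.autToPow K) (hz.autToPow_injective K)

lemma finrank_adjoin_simple_of_irreducible {ℓ : ℕ} {α : L} {a : K} (hℓ : ℓ ≠ 0)
    (ha : α ^ ℓ = algebraMap K L a) (h : Irreducible (X ^ ℓ - C a)) :
    Module.finrank K K⟮α⟯ = ℓ := by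
  have hroot : aeval α (X ^ ℓ - C a) = 0 := by
    rw [map_sub, map_pow, aeval_X, aeval_C, ha, sub_self]
  have hmonic : (X ^ ℓ - C a).Monic := monic_X_pow_sub_C a hℓ
  rw [IntermediateField.adjoin.finrank ⟨_, hmonic, hroot⟩,
    ← minpoly.eq_of_irreducible_of_monic h hroot hmonic, natDegree_X_pow_sub_C]

/-- An `ℓ`-th root of `a` in `K(ζ)` would generate a subfield of degree `ℓ`, but `K(ζ)` has degree
at most `ℓ - 1`. -/
lemma irreducible_map_adjoin_root_of_unity {Ω : Type*} [Field Ω] [Algebra K Ω] {ℓ : ℕ}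
    (hℓ : ℓ.Prime) {ζ : Ω} (hζ : IsPrimitiveRoot ζ ℓ) {a : K} (h : Irreducible (X ^ ℓ - C a)) :
    Irreducible (X ^ ℓ - C (algebraMap K K⟮ζ⟯ a)) := by
  rw [X_pow_sub_C_irreducible_iff_of_prime hℓ]
  intro b hb
  have h1 := finrank_adjoin_simple_of_irreducible hℓ.ne_zero hb h
  have hcyc : aeval ζ (cyclotomic ℓ K) = 0 := by
    have : NeZero (ℓ : Ω) := ⟨by
      rw [← map_natCast (algebraMap K Ω), Ne, map_eq_zero, Nat.cast_eq_zero]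
      exact hℓ.ne_zero⟩
    have := (isRoot_cyclotomic_iff (n := ℓ) (R := Ω)).mpr hζ
    rwa [aeval_def, eval₂_eq_eval_map, map_cyclotomic]
  have hint : IsIntegral K ζ := ⟨_, cyclotomic.monic ℓ K, hcyc⟩
  have : FiniteDimensional K K⟮ζ⟯ := IntermediateField.adjoin.finiteDimensional hint
  have h2 : Module.finrank K K⟮ζ⟯ ≤ ℓ - 1 := by
    rw [IntermediateField.adjoin.finrank hint, ← Nat.totient_prime hℓ, ← natDegree_cyclotomic ℓ K]
    exact natDegree_le_of_dvd (minpoly.dvd _ _ hcyc) (cyclotomic_ne_zero ℓ K)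
  have h3 := IntermediateField.finrank_le_of_le_right (F := K⟮b⟯) (E := ⊤) le_top
  rw [h1, IntermediateField.finrank_top'] at h3
  have := hℓ.pos
  omega

lemma exists_isCyclicExtension_adjoin {Ω : Type*} [Field Ω] [Algebra K Ω] [Algebra L Ω]
    [IsScalarTower K L Ω] {ℓ : ℕ} (hℓ : ℓ.Prime) {ζ : Ω} (hζ : IsPrimitiveRoot ζ ℓ) {α : L} {a : K}
    (ha : α ^ ℓ = algebraMap K L a) (h : Irreducible (X ^ ℓ - C a)) :
    ∃ F : IntermediateField K⟮ζ⟯ Ω, (F : Set Ω) ⊆ (L⟮ζ⟯ : Set Ω) ∧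
      IsCyclicExtension K⟮ζ⟯ F ∧ Module.finrank K⟮ζ⟯ F = ℓ := by
  have h' := irreducible_map_adjoin_root_of_unity hℓ hζ h
  set α' : Ω := algebraMap L Ω α with hα'
  have ha' : α' ^ ℓ = algebraMap K⟮ζ⟯ Ω (algebraMap K K⟮ζ⟯ a) := by
    rw [← IsScalarTower.algebraMap_apply, hα', ← map_pow, ha, ← IsScalarTower.algebraMap_apply]
  have hfin := finrank_adjoin_simple_of_irreducible hℓ.ne_zero ha' h'
  have hfd : FiniteDimensional K⟮ζ⟯ K⟮ζ⟯⟮α'⟯ :=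
    FiniteDimensional.of_finrank_pos (hfin ▸ hℓ.pos)
  have hζL : ζ ∈ L⟮ζ⟯ := IntermediateField.mem_adjoin_simple_self L ζ
  have hsub : K⟮ζ⟯.toSubfield ≤ L⟮ζ⟯.toSubfield := by
    refine IntermediateField.adjoin_le_subfield K {ζ} ?_ ?_
    · rintro _ ⟨k, rfl⟩
      rw [IsScalarTower.algebraMap_apply K L Ω]
      exact L⟮ζ⟯.algebraMap_mem _
    · exact Set.singleton_subset_iff.mpr hζL
  refine ⟨K⟮ζ⟯⟮α'⟯, ?_, ⟨hfd, ?_⟩, hfin⟩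
  · have : K⟮ζ⟯⟮α'⟯.toSubfield ≤ L⟮ζ⟯.toSubfield := by
      refine IntermediateField.adjoin_le_subfield K⟮ζ⟯ {α'} ?_ ?_
      · rintro _ ⟨k, rfl⟩
        exact hsub k.2
      · exact Set.singleton_subset_iff.mpr (L⟮ζ⟯.algebraMap_mem α)
    exact this
  · have hprim : IsPrimitiveRoot (IntermediateField.AdjoinSimple.gen K ζ) ℓ :=
      IsPrimitiveRoot.of_map_of_injective (f := algebraMap K⟮ζ⟯ Ω)
        (by rwa [IntermediateField.AdjoinSimple.algebraMap_gen]) (algebraMap K⟮ζ⟯ Ω).injective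
    have htfae := isCyclic_tfae K⟮ζ⟯ K⟮ζ⟯⟮α'⟯ (by
      rw [hfin]
      exact ⟨_, (mem_primitiveRoots hℓ.pos).mpr hprim⟩)
    have hα : IntermediateField.AdjoinSimple.gen K⟮ζ⟯ α' ^ Module.finrank K⟮ζ⟯ K⟮ζ⟯⟮α'⟯ =
        algebraMap K⟮ζ⟯ _ (algebraMap K K⟮ζ⟯ a) := by
      rw [hfin]
      apply (algebraMap K⟮ζ⟯⟮α'⟯ Ω).injective
      rw [map_pow, IntermediateField.AdjoinSimple.algebraMap_gen, ha']
      rfl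
    have htop : K⟮ζ⟯⟮IntermediateField.AdjoinSimple.gen K⟮ζ⟯ α'⟯ = ⊤ := by
      apply IntermediateField.lift_injective
      rw [IntermediateField.lift_adjoin_simple, IntermediateField.lift_top,
        IntermediateField.AdjoinSimple.coe_gen]
    -- Entry 2 is generation by a radical of exponent the degree; entry 0 is Galois with cyclic
    -- group.
    have h20 := htfae.out 2 0
    exact h20.mp ⟨_, ⟨_, hα.symm⟩, htop⟩

end Kummer

namespace WeierstrassCurve.Affine

open Polynomial

/-! ### From a division point to a radical element. -/

section Descent

variable {K N F : Type*} [Field K] [CharZero K] [Field N] [Algebra K N] [FiniteDimensional K N]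
  [Field F] [Algebra K F] [Algebra N F] [IsScalarTower K N F] [IsAlgClosed F]
  [Algebra.IsAlgebraic K F] [DecidableEq K] [DecidableEq N] [DecidableEq F]
  {E : Affine K} [E.IsElliptic]

/-- If `Q` generates `N` and its conjugates differ by multiples of a rational torsion point, then
`N` is cyclic. -/
theorem isGalois_and_isCyclic_of_conj {P : (E⁄K).Point} {Q : (E⁄N).Point}
    (hgen : ∀ s t : N →ₐ[K] F, Point.map (W' := E) s Q = Point.map t Q → s = t)
    (h : ∀ τ : F ≃ₐ[K] F, Point.map (W' := E) (τ : F →ₐ[K] F) (Point.baseChange N F Q) -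
      Point.baseChange N F Q ∈ AddSubgroup.zmultiples (Point.baseChange (W' := E) K F P)) :
    IsGalois K N ∧ IsCyclic (N ≃ₐ[K] N) := by
  have : IsAlgClosure K F := ⟨inferInstance, inferInstance⟩
  have : Normal K F := IsAlgClosure.normal K F
  have hF : IsGalois K F := ⟨⟩
  let i : N →ₐ[K] F := IsScalarTower.toAlgHom K N F
  have hi : Point.baseChange (W' := E) N F Q = Point.map (W' := E) i Q := by
    rcases Q with _ | ⟨_, _, _⟩ <;> rfl
  have hnormal : Normal K i.fieldRange := by
    rw [IntermediateField.normal_iff_forall_map_le']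
    rintro τ _ ⟨_, ⟨x, rfl⟩, rfl⟩
    -- By Galois theory it suffices that an automorphism `g` fixing `N` also fixes `τ(N)`: `τQ` is
    -- `Q` plus a rational point, so `g` fixes `τQ`, and `Q` generates `N`.
    rw [← InfiniteGalois.fixedField_fixingSubgroup i.fieldRange,
      IntermediateField.mem_fixedField_iff]
    intro g hg
    have hgi : (g : F →ₐ[K] F).comp i = i := by
      ext y
      exact (IntermediateField.mem_fixingSubgroup_iff _ _).mp hg _ ⟨y, rfl⟩
    have hs : (g : F →ₐ[K] F).comp ((τ : F →ₐ[K] F).comp i) = (τ : F →ₐ[K] F).comp i := by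
      apply hgen
      obtain ⟨k, hk⟩ := AddSubgroup.mem_zmultiples_iff.mp (h τ)
      rw [hi, Point.map_map, eq_sub_iff_add_eq] at hk
      rw [← Point.map_map, ← hk, map_add, map_zsmul, Point.map_baseChange, Point.map_map, hgi]
    exact congr($hs x)
  have e : N ≃ₐ[K] i.fieldRange := AlgEquiv.ofInjectiveField i
  have hN : Normal K N := Normal.of_algEquiv e.symm
  refine ⟨⟨⟩, ?_⟩
  have hmem (g : N ≃ₐ[K] N) : Point.map (W' := E) (g : N →ₐ[K] N) Q - Q ∈
      AddSubgroup.zmultiples (Point.baseChange (W' := E) K N P) := by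
    obtain ⟨k, hk⟩ := AddSubgroup.mem_zmultiples_iff.mp (h (g.liftNormal F))
    refine AddSubgroup.mem_zmultiples_iff.mpr ⟨k, ?_⟩
    apply Point.map_injective (W' := E) i
    rw [map_zsmul, Point.map_baseChange, hk, map_sub, hi, Point.map_map, Point.map_map]
    congr 3
    ext x
    exact (g.liftNormal_commutes F x)
  -- The map `g ↦ gQ - Q` is a homomorphism because its values are multiples of the rational point
  -- `P`.
  let φ : (N ≃ₐ[K] N) →* Multiplicative (AddSubgroup.zmultiples (Point.baseChange (W' := E) K N P)) :=
    { toFun := fun g => .ofAdd ⟨_, hmem g⟩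
      map_one' := by
        apply Multiplicative.toAdd.injective
        refine Subtype.ext ?_
        change Point.map (W' := E) ((1 : N ≃ₐ[K] N) : N →ₐ[K] N) Q - Q = 0
        rw [sub_eq_zero]
        rcases Q with _ | ⟨_, _, _⟩ <;> rfl
      map_mul' := fun g g' => by
        apply Multiplicative.toAdd.injective
        refine Subtype.ext ?_
        change Point.map (W' := E) ((g * g' : N ≃ₐ[K] N) : N →ₐ[K] N) Q - Q =
          (Point.map (W' := E) (g : N →ₐ[K] N) Q - Q) + (Point.map (W' := E) (g' : N →ₐ[K] N) Q - Q)
        obtain ⟨k, hk⟩ := AddSubgroup.mem_zmultiples_iff.mp (hmem g')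
        have : Point.map (W' := E) ((g * g' : N ≃ₐ[K] N) : N →ₐ[K] N) Q =
            Point.map (W' := E) (g : N →ₐ[K] N) (Point.map (W' := E) (g' : N →ₐ[K] N) Q) := by
          rw [Point.map_map]; rfl
        rw [← hk, this, ← sub_add_cancel (Point.map (W' := E) (g' : N →ₐ[K] N) Q) Q, ← hk, map_add,
          map_zsmul, Point.map_baseChange]
        abel }
  refine isCyclic_of_injective φ fun g g' hgg => ?_
  have h1 : Point.map (W' := E) (g : N →ₐ[K] N) Q - Q = Point.map (W' := E) (g' : N →ₐ[K] N) Q - Q :=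
    congrArg Subtype.val (Multiplicative.ofAdd.injective hgg)
  have h2 : i.comp (g : N →ₐ[K] N) = i.comp (g' : N →ₐ[K] N) := by
    apply hgen
    rw [← Point.map_map, ← Point.map_map, sub_left_injective h1]
  ext x
  exact i.injective congr($h2 x)

/-- A point `Q` generating `N` one of whose prime multiples `ℓ • Q` is rational yields a radical
element of `N`, which is rational only if `N` is cyclic. -/
theorem exists_pow_eq {ℓ : ℕ} (hℓ : ℓ.Prime) {P R : (E⁄K).Point} (hP : addOrderOf P = ℓ)
    {Q : (E⁄N).Point} (hQ : ℓ • Q = Point.baseChange K N R)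
    (hgen : ∀ s t : N →ₐ[K] F, Point.map (W' := E) s Q = Point.map t Q → s = t) :
    ∃ (α : N) (a : K), α ^ ℓ = algebraMap K N a ∧
      (α ∈ Set.range (algebraMap K N) → IsGalois K N ∧ IsCyclic (N ≃ₐ[K] N)) := by
  have : IsAlgClosure K F := ⟨inferInstance, inferInstance⟩
  have : Normal K F := IsAlgClosure.normal K F
  have hF : IsGalois K F := ⟨⟩
  have : CharZero F := charZero_of_injective_algebraMap (algebraMap K F).injective
  let i : N →ₐ[K] F := IsScalarTower.toAlgHom K N F
  have hi : Point.baseChange (W' := E) N F Q = Point.map (W' := E) i Q := by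
    rcases Q with _ | ⟨_, _, _⟩ <;> rfl
  have hPF : addOrderOf (Point.baseChange (W' := E) K F P) = ℓ := by
    rw [← hP]
    exact addOrderOf_injective _ (Point.map_injective _) P
  obtain ⟨e, he0, hne, hadd, hσ, hker⟩ := exists_pairing E hℓ hPF fun σ => Point.map_baseChange _ P
  let d : (N →ₐ[K] F) → (E⁄F).Point := fun s => Point.map (W' := E) s Q - Point.map (W' := E) i Q
  have hd (s : N →ₐ[K] F) : ℓ • d s = 0 := by
    rw [nsmul_sub, ← map_nsmul, ← map_nsmul, hQ, Point.map_baseChange, Point.map_baseChange, sub_self]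
  have hdτ (τ : F ≃ₐ[K] F) (s : N →ₐ[K] F) : d ((τ : F →ₐ[K] F).comp s) =
      Point.map (W' := E) (τ : F →ₐ[K] F) (d s) + d ((τ : F →ₐ[K] F).comp i) := by
    simp only [d, map_sub, Point.map_map]
    abel
  have heτ (τ : F ≃ₐ[K] F) (s : N →ₐ[K] F) : e (d ((τ : F →ₐ[K] F).comp s)) =
      τ (e (d s)) * e (d ((τ : F →ₐ[K] F).comp i)) := by
    rw [hdτ, hadd _ _ (by rw [← map_nsmul, hd, _root_.map_zero]) (hd _), hσ τ _ (hd s)]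
  -- Hilbert 90 over the embeddings of `N`, which need not be Galois: independence of the embeddings
  -- makes the resolvent nonzero for some `θ`.
  have hex : ∃ θ : N, ∑ s : N →ₐ[K] F, (e (d s))⁻¹ * s θ ≠ 0 := by
    by_contra! hcon
    have hind := (linearIndependent_monoidHom N F).comp
      (fun s : N →ₐ[K] F => ((s : N →+* F) : N →* F)) fun s t hst => by
        ext x
        exact congr($hst x)
    rw [Fintype.linearIndependent_iff] at hind
    refine inv_ne_zero (hne _ (hd i)) (hind (fun s => (e (d s))⁻¹) ?_ i)
    ext θ
    rw [Finset.sum_apply, Pi.zero_apply, ← hcon θ]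
    rfl
  obtain ⟨θ, hθ⟩ := hex
  set α := ∑ s : N →ₐ[K] F, (e (d s))⁻¹ * s θ with hα
  have hτα (τ : F ≃ₐ[K] F) : τ α = e (d ((τ : F →ₐ[K] F).comp i)) * α := by
    have hbij : Function.Bijective fun s : N →ₐ[K] F => (τ : F →ₐ[K] F).comp s := by
      rw [← Finite.injective_iff_bijective]
      intro s t hst
      ext x
      exact τ.injective congr($hst x)
    nth_rw 2 [hα]
    rw [hα, map_sum, Finset.mul_sum]
    refine Fintype.sum_bijective _ hbij _ _ fun s => ?_
    rw [heτ τ s, map_mul, map_inv₀, mul_inv, ← mul_assoc, mul_comm (e _), mul_assoc _ _ (e _),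
      inv_mul_cancel₀ (hne _ (hd _)), mul_one]
    rfl
  -- An automorphism fixing `N` fixes `Q`, so its factor `e(τQ - Q)` is `e 0 = 1`.
  have hαN : α ∈ i.fieldRange := by
    rw [← InfiniteGalois.fixedField_fixingSubgroup i.fieldRange,
      IntermediateField.mem_fixedField_iff]
    intro τ hτ
    have hτi : (τ : F →ₐ[K] F).comp i = i := by
      ext y
      exact (IntermediateField.mem_fixingSubgroup_iff _ _).mp hτ _ ⟨y, rfl⟩
    rw [hτα, hτi, show d i = 0 from sub_self _, he0, one_mul]
  obtain ⟨α₀, hα₀ : i α₀ = α⟩ := hαN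
  have hpow {T : (E⁄F).Point} (hT : ℓ • T = 0) (n : ℕ) : e (n • T) = e T ^ n := by
    induction n with
    | zero => rw [zero_nsmul, he0, pow_zero]
    | succ n ih =>
      rw [succ_nsmul, hadd _ _ (by rw [← mul_nsmul', mul_comm, mul_nsmul', hT, nsmul_zero]) hT, ih,
        pow_succ]
  have hαℓ : α ^ ℓ ∈ Set.range (algebraMap K F) := by
    rw [InfiniteGalois.mem_range_algebraMap_iff_fixed]
    intro τ
    rw [map_pow, hτα, mul_pow, ← hpow (hd _), hd, he0, one_mul]
  obtain ⟨a, ha⟩ := hαℓ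
  refine ⟨α₀, a, ?_, ?_⟩
  · refine i.injective (?_ : i (α₀ ^ ℓ) = i (algebraMap K N a))
    rw [map_pow, hα₀, ← ha, AlgHom.commutes]
  · rintro ⟨b, rfl⟩
    rw [AlgHom.commutes] at hα₀
    -- For rational `α ≠ 0` every factor `e(τQ - Q)` equals `1`, and nondegeneracy puts `τQ - Q` in
    -- `⟨P⟩`.
    refine isGalois_and_isCyclic_of_conj (P := P) hgen fun τ => ?_
    rw [hi, Point.map_map]
    refine hker _ (hd _) ?_
    have := hτα τ
    rw [← hα₀, AlgEquiv.commutes, hα₀] at this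
    exact mul_right_cancel₀ hθ (this.symm.trans (one_mul _).symm)

end Descent

end WeierstrassCurve.Affine

/-! ### Assembling the proof. -/

lemma exists_nsmul_pow_notMem {G : Type*} [AddCommGroup G] {ℓ : ℕ} {H : AddSubgroup G} {g : G}
    (hg : g ∉ H) (h : ∃ k : ℕ, ℓ ^ k • g = 0) : ∃ g' : G, g' ∉ H ∧ ℓ • g' ∈ H := by
  classical
  have hex : ∃ k : ℕ, ℓ ^ k • g ∈ H := by
    obtain ⟨k, hk⟩ := h
    exact ⟨k, hk ▸ zero_mem H⟩
  obtain ⟨n, hn⟩ : ∃ n, Nat.find hex = n + 1 := by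
    refine Nat.exists_eq_succ_of_ne_zero fun h0 => hg ?_
    have := Nat.find_spec hex
    rwa [h0, pow_zero, one_nsmul] at this
  -- The last `ℓ`-power multiple of `g` before the multiples first enter `H`.
  refine ⟨ℓ ^ n • g, Nat.find_min hex (by omega), ?_⟩
  have := Nat.find_spec hex
  rwa [hn, pow_succ', mul_nsmul'] at this

namespace WeierstrassCurve.Affine

/-- Completing the square in `y` makes `(y + (a₁x + a₃)/2) ^ 2` a polynomial in `x`. -/
lemma isIntegral_y {K L : Type*} [Field K] [CharZero K] [Field L] [Algebra K L] {E : Affine K}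
    {a b : L} (h : (E⁄L).Equation a b) (ha : _root_.IsIntegral K a) : _root_.IsIntegral K b := by
  have hc (c : K) : _root_.IsIntegral K (algebraMap K L c) := _root_.isIntegral_algebraMap
  rw [equation_iff] at h
  change b ^ 2 + algebraMap K L E.a₁ * a * b + algebraMap K L E.a₃ * b =
    a ^ 3 + algebraMap K L E.a₂ * a ^ 2 + algebraMap K L E.a₄ * a + algebraMap K L E.a₆ at h
  have h2 : algebraMap K L (1 / 2) * 2 = 1 := by
    rw [← map_ofNat (algebraMap K L) 2, ← map_mul, one_div_mul_cancel two_ne_zero, map_one]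
  set u := b + algebraMap K L (1 / 2) * (algebraMap K L E.a₁ * a + algebraMap K L E.a₃) with hu
  have hl : _root_.IsIntegral K (algebraMap K L (1 / 2) * (algebraMap K L E.a₁ * a + algebraMap K L E.a₃)) :=
    (hc _).mul (((hc _).mul ha).add (hc _))
  have hu2 : u ^ 2 = a ^ 3 + algebraMap K L E.a₂ * a ^ 2 + algebraMap K L E.a₄ * a +
      algebraMap K L E.a₆ +
      (algebraMap K L (1 / 2) * (algebraMap K L E.a₁ * a + algebraMap K L E.a₃)) ^ 2 := by
    rw [hu]
    linear_combination h + b * (algebraMap K L E.a₁ * a + algebraMap K L E.a₃) * h2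
  have hui : _root_.IsIntegral K u := by
    refine _root_.IsIntegral.of_pow two_pos ?_
    rw [hu2]
    exact ((((ha.pow 3).add ((hc _).mul (ha.pow 2))).add ((hc _).mul ha)).add (hc _)).add (hl.pow 2)
  have := hui.sub hl
  rwa [hu, add_sub_cancel_right] at this

/-- A new `ℓ`-primary point over `L` yields a cyclic subextension or a radical element of `L`. -/
theorem exists_isCyclicExtension_or_exists_pow_eq {K : Type*} [Field K] [CharZero K] [DecidableEq K]
    (E : Affine K) [E.IsElliptic] {ℓ : ℕ} (hℓ : ℓ.Prime) {L : Type*} [Field L] [DecidableEq L]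
    [Algebra K L] (hK : ellPrimaryTorsion E K ℓ ≠ ⊥)
    (hL : (ellPrimaryTorsion E K ℓ).map (Point.baseChange K L) < ellPrimaryTorsion E L ℓ) :
    (∃ F : IntermediateField K L, F ≠ ⊥ ∧ IsCyclicExtension K F) ∨
      ∃ (α : L) (a : K), α ^ ℓ = algebraMap K L a ∧ α ∉ Set.range (algebraMap K L) := by
  classical
  have : Fact ℓ.Prime := ⟨hℓ⟩
  obtain ⟨P, hP⟩ : ∃ P : (E⁄K).Point, addOrderOf P = ℓ := by
    obtain ⟨⟨P₁, hP₁⟩, hne⟩ := AddSubgroup.ne_bot_iff_exists_ne_zero.mp hK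
    obtain ⟨P, hP0, hPℓ⟩ := exists_nsmul_pow_notMem (H := (⊥ : AddSubgroup (E⁄K).Point))
      (fun h => hne (Subtype.ext (AddSubgroup.mem_bot.mp h))) hP₁
    exact ⟨P, addOrderOf_eq_prime (AddSubgroup.mem_bot.mp hPℓ)
      fun h => hP0 (AddSubgroup.mem_bot.mpr h)⟩
  -- The subgroup used is all of `E(K)`, not only its `ℓ`-primary part: injectivity of base change
  -- makes any rational point killed by a power of `ℓ` over `L` already `ℓ`-primary over `K`.
  obtain ⟨Q, hQ, R, hR⟩ : ∃ Q : (E⁄L).Point, Q ∉ (Point.baseChange (W' := E) K L).range ∧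
      ℓ • Q ∈ (Point.baseChange (W' := E) K L).range := by
    obtain ⟨Q₁, ⟨k, hk⟩, hQ₁⟩ := SetLike.exists_of_lt hL
    refine exists_nsmul_pow_notMem (g := Q₁) ?_ ⟨k, hk⟩
    rintro ⟨S, rfl⟩
    refine hQ₁ ⟨S, ⟨k, ?_⟩, rfl⟩
    apply Point.map_injective (W' := E) (Algebra.ofId K L)
    rw [_root_.map_zero]
    exact (map_nsmul (Point.baseChange (W' := E) K L) _ _).trans hk
  rcases Q with _ | ⟨a, b, hab⟩
  · exact absurd (zero_mem _) hQ
  have ha : _root_.IsIntegral K a := by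
    have : CharZero (AlgebraicClosure K) :=
      charZero_of_injective_algebraMap (algebraMap K (AlgebraicClosure K)).injective
    have hP' : addOrderOf (Point.baseChange (W' := E) K (AlgebraicClosure K) P) = ℓ := by
      rw [← hP]
      exact addOrderOf_injective _ (Point.map_injective _) P
    exact (isAlgebraic_of_nsmul_eq hℓ hP' (fun σ => Point.map_baseChange _ P) hab hR.symm).isIntegral
  have hb : _root_.IsIntegral K b := isIntegral_y hab.1 ha
  let N := IntermediateField.adjoin K ({a, b} : Set L)
  have haN : a ∈ N := IntermediateField.subset_adjoin _ _ (by simp)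
  have hbN : b ∈ N := IntermediateField.subset_adjoin _ _ (by simp)
  have hfd : FiniteDimensional K N := by
    refine IntermediateField.finiteDimensional_adjoin ?_
    rintro x (rfl | rfl)
    exacts [ha, hb]
  have hNbot : N ≠ ⊥ := by
    intro h
    obtain ⟨a₀, ha₀⟩ := IntermediateField.mem_bot.mp (h ▸ haN)
    obtain ⟨b₀, hb₀⟩ := IntermediateField.mem_bot.mp (h ▸ hbN)
    subst ha₀ hb₀
    exact hQ ⟨.some a₀ b₀ ((E.baseChange_nonsingular (f := Algebra.ofId K L)
      (Algebra.ofId K L).injective _ _).mp hab), rfl⟩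
  let Q : (E⁄N).Point := .some (⟨a, haN⟩ : N) ⟨b, hbN⟩
    ((E.baseChange_nonsingular (f := N.val) N.val.injective _ _).mp hab)
  have hQN : ℓ • Q = Point.baseChange K N R := by
    apply Point.map_injective (W' := E) N.val
    rw [map_nsmul, Point.map_baseChange, hR]
    rfl
  obtain ⟨α, c, hα, hcyc⟩ := exists_pow_eq (F := AlgebraicClosure N) hℓ hP hQN fun s t hst => by
    have h := Point.some.inj hst
    refine IntermediateField.algHom_ext_of_eq_adjoin _ (S := N) (s := {a, b}) rfl ?_
    rintro x (rfl | rfl)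
    exacts [h.1, h.2]
  by_cases hαK : α ∈ Set.range (algebraMap K N)
  · exact .inl ⟨N, hNbot, hfd, hcyc hαK⟩
  have hα' : (α : L) ^ ℓ = algebraMap K L c := congrArg Subtype.val hα
  have hαL : (α : L) ∉ Set.range (algebraMap K L) := by
    rintro ⟨k, hk⟩
    exact hαK ⟨k, Subtype.ext hk⟩
  exact .inr ⟨α, c, hα', hαL⟩

end WeierstrassCurve.Affine

/-- `Ω` is any extension field of `L` containing a primitive `ℓ`-th root of unity `ζ` (such as an
algebraic closure of `L`); the fields `K(ζ)` and `L(ζ)` are formed inside `Ω`. -/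
theorem corollary2p4 {K : Type*} [Field K] [CharZero K] [DecidableEq K]
    (E : WeierstrassCurve.Affine K) [E.IsElliptic] (ℓ : ℕ) (hℓ : ℓ.Prime)
    {L : Type*} [Field L] [DecidableEq L] [Algebra K L]
    (hK : ellPrimaryTorsion E K ℓ ≠ ⊥)
    (hL : (ellPrimaryTorsion E K ℓ).map (WeierstrassCurve.Affine.Point.baseChange K L) <
      ellPrimaryTorsion E L ℓ)
    {Ω : Type*} [Field Ω] [Algebra K Ω] [Algebra L Ω] [IsScalarTower K L Ω]
    (ζ : Ω) (hζ : IsPrimitiveRoot ζ ℓ) :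
    (∃ F : IntermediateField K L, F ≠ ⊥ ∧ IsCyclicExtension K F) ∨
    ((∃ F : IntermediateField K⟮ζ⟯ Ω, (F : Set Ω) ⊆ (L⟮ζ⟯ : Set Ω) ∧
        IsCyclicExtension K⟮ζ⟯ F ∧ Module.finrank K⟮ζ⟯ F = ℓ) ∧
      ∃ F : IntermediateField K L, Module.finrank K F = ℓ ∨ Module.finrank K F = ℓ ^ 2) := by
  rcases WeierstrassCurve.Affine.exists_isCyclicExtension_or_exists_pow_eq E hℓ hK hL with
    h | ⟨α, a, ha, hα⟩
  · exact .inl h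
  rcases irreducible_or_exists_isCyclicExtension hℓ ha hα with hirr | h
  · exact .inr ⟨exists_isCyclicExtension_adjoin hℓ hζ ha hirr, K⟮α⟯,
      -- The field `K(α)` has degree exactly `ℓ`, so the alternative `ℓ ^ 2` is never needed.
      .inl (finrank_adjoin_simple_of_irreducible hℓ.ne_zero ha hirr)⟩
  · exact .inl h
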